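/- **Model.** Time is divided into slots $0,1,2,\dots$ on a single-hop, single-channel network with a trusted sender Alice, $n$ correct nodes, an adversary Carol, and $\lfloor fn\rfloor$ Byzantine nodes controlled by Carol, where $f>0$ is a constant. In each slot a device sleeps (cost $0$), listens, or transmits (cost $1$); attacking (jamming or spoofing) costs an adversarial device $1$. For a constant $C>0$, each Byzantine node has total budget $C\sqrt n$ and Carol has $C\sqrt n\ln n$; a device with exhausted budget sleeps. A listening device hears silence if no signal of another device reaches it, the frame if exactly one frame and no jamming reaches it, and noise otherwise. The message $m$ of Alice is authenticated: it can be transmitted only by those who possess it, and any other attempt to transmit it is mere noise. Carol is $n$-uniform (an attack may affect every correct device differently), adaptive (her possibly randomised strategy sees everything that happened in earlier slots) and not reactive (she does not see the current slot). An algorithm prescribes, for each correct device, a probability distribution of its next action as a function of what this device has done and heard so far; the devices draw independently. A correct node is informed once it has received $m$. **Protocol** (constants $\varepsilon',c>0$). All probabilities are truncated at $1$. Rounds $i=1,2,\dots$ consist of three phases of $\lceil 2^{3i/2}\rceil$ slots each. *Inform phase:* in each slot Alice sends $m$ with probability $2\ln n/2^{i}$, and each uninformed node listens with probability $2/(\varepsilon'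 2^{i})$. *Propagation phase:* each node informed before the phase (and not yet terminated) sends $m$ in each slot with probability $1/n$ and terminates at the end of the phase; each uninformed node listens with probability $4e(c+1)/2^{i}$; a node informed during this phase does nothing more; Alice sleeps. *Request phase:* each uninformed node sends a $\mathtt{nack}$ in each slot with probability $1/n$ and, if it does not send, listens with probability $(c+1)/((1-e^{-64\varepsilon'})2^{i})$; Alice listens with probability $c\ln n/((1-e^{-4\varepsilon'})2^{3i/2})$. At the end of the request phase of a round $i\ge 3\log_2\ln n$, Alice and each uninformed node terminate if they heard at most $5c\ln n$ noisy (non-silent) slots in this phase. **Corollary (the latency of the protocol is asymptotically optimal).** Let $f,C>0$. 1. Carol and her Byzantine nodes can jam continuously for $\Theta(n^{3/2})$ slots: there are $c_1,c_2>0$ such that for all sufficiently large $n$ (i) some strategy of Carol, against every algorithm and with certainty, makes every one of the first $\lfloor c_1n^{3/2}\rfloor$ slots mere noise for all correct devices, so that no correct node receives $m$ in these slots; and (ii) no strategy ever attacks in more than $c_2n^{3/2}$ slots. 2. Hence no algorithm delivers the message to any correct node in $o(n^{3/2})$ slots: if $T(n)=o(n^{3/2})$, then for all sufficiently large $n$ and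 every algorithm there is a strategy of Carol under which, with probability $1$, no correct node receives $m$ in the first $T(n)$ slots. 3. The protocol has latency $O(n^{3/2})$: for all $\varepsilon,\gamma>0$, all sufficiently small $\varepsilon'>0$ (depending on $f,C,\varepsilon,\gamma$) and all sufficiently large $c$ (depending also on $\varepsilon'$) there are constants $K,C'>0$ such that for all sufficiently large $n$ and every strategy of Carol, with probability at least $1-n^{-\gamma}$, at least $(1-\varepsilon)n$ correct nodes have received $m$ within the first $\lfloor Kn^{3/2}\rfloor$ slots, and in these slots Alice spends at most $C'\sqrt n\ln n$ and each correct node at most $C'\sqrt n$. -/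

import Mathlib

open Filter Asymptotics

noncomputable section

namespace Jam

/-! ### The single-hop channel

There are `n + 1` correct devices, indexed by `Fin (n + 1)`: device `0` is Alice and the devices
`v.succ` are the `n` correct nodes. There are `b + 1` adversarial devices, indexed by
`Fin (b + 1)`: device `0` is Carol herself, the others are her `b` Byzantine nodes.
Time is divided into slots `0, 1, 2, …`. -/

/-- What can be transmitted: the authenticated message `m` of Alice (`msg`), or anything else. -/
inductive Frame (Φ : Type) : Type
  | msg : Frame Φ
  | other : Φ → Frame Φ

/-- The action of a correct device in a slot. -/
inductive Action (Φ : Type) : Type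
  | sleep : Action Φ
  | listen : Action Φ
  | send : Frame Φ → Action Φ

/-- A physical signal: a decodable frame, or mere noise. -/
inductive Signal (Φ : Type) : Type
  | frame : Frame Φ → Signal Φ
  | noise : Signal Φ

/-- What a listening device perceives in a slot. Jamming cannot be told from a collision. -/
inductive Heard (Φ : Type) : Type
  | silence : Heard Φ
  | noise : Heard Φ
  | frame : Frame Φ → Heard Φ

/-- The action of an adversarial device in a slot. An attack chooses, separately for every correct
device, a signal to be superposed on the channel as perceived by that device (`noise` jams it,
a frame is a spoofed or replayed transmission), or no signal. -/
inductive AdvAction (n : ℕ) (Φ : Type) : Type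
  | sleep : AdvAction n Φ
  | listen : AdvAction n Φ
  | attack : (Fin (n + 1) → Option (Signal Φ)) → AdvAction n Φ

/-- What all devices did in one slot. -/
structure Slot (n b : ℕ) (Φ : Type) : Type where
  act : Fin (n + 1) → Action Φ
  adv : Fin (b + 1) → AdvAction n Φ

/-- Who is in possession of `m`. -/
structure Knowledge (n : ℕ) : Type where
  holds : Fin (n + 1) → Bool
  carol : Bool

variable {n b : ℕ} {Φ : Type}

/-- A transmission of `m` by somebody who does not possess it fails authentication:
it is only noise. -/
def authentic (owns : Bool) : Frame Φ → Signal Φ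
  | .msg => if owns then .frame .msg else .noise
  | .other x => .frame (.other x)

/-- The signal emitted by the correct device `d`. -/
def emit (K : Knowledge n) (s : Slot n b Φ) (d : Fin (n + 1)) : Option (Signal Φ) :=
  match s.act d with
  | .send x => some (authentic (K.holds d) x)
  | _ => none

/-- The signal that the adversarial device `e` causes at the correct device `d`. -/
def emitAdv (K : Knowledge n) (s : Slot n b Φ) (d : Fin (n + 1)) (e : Fin (b + 1)) :
    Option (Signal Φ) :=
  match s.adv e with
  | .attack target =>
      match target d with
      | some (.frame x) => some (authentic K.carol x)
      | some .noise => some .noise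
      | none => none
  | _ => none

/-- All the signals that reach the correct device `d` in a slot (not its own). -/
def signalsAt (K : Knowledge n) (s : Slot n b Φ) (d : Fin (n + 1)) : List (Signal Φ) :=
  ((List.finRange (n + 1)).filter (fun d' => d' ≠ d)).filterMap (emit K s) ++
    (List.finRange (b + 1)).filterMap (emitAdv K s d)

/-- No signal is silence, a single frame is received, everything else is noise. -/
def resolve : List (Signal Φ) → Heard Φ
  | [] => .silence
  | [.frame x] => .frame x
  | _ => .noise

/-- What the correct device `d` hears; `none` if it does not listen. -/
def heard (K : Knowledge n) (s : Slot n b Φ) (d : Fin (n + 1)) : Option (Heard Φ) :=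
  match s.act d with
  | .listen => some (resolve (signalsAt K s d))
  | _ => none

/-- Reception of `m`. -/
def isMsg : Option (Heard Φ) → Bool
  | some (.frame .msg) => true
  | _ => false

/-- Anything but silence was heard. -/
def isNoisy : Option (Heard Φ) → Bool
  | some .noise => true
  | some (.frame _) => true
  | _ => false

def AdvAction.isListen : AdvAction n Φ → Bool
  | .listen => true
  | _ => false

def AdvAction.isAttack : AdvAction n Φ → Bool
  | .attack _ => true
  | _ => false

def AdvAction.isActive : AdvAction n Φ → Bool
  | .sleep => false
  | _ => true

def Action.isActive : Action Φ → Bool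
  | .sleep => false
  | _ => true

/-- Initially only Alice has `m`. A correct device gets it by receiving it. The adversary gets it
when one of her devices listens in a slot in which the only correct transmission is `m`. -/
def Knowledge.update (K : Knowledge n) (s : Slot n b Φ) : Knowledge n where
  holds d := K.holds d || isMsg (heard K s d)
  carol := K.carol ||
    ((List.finRange (b + 1)).any (fun e => (s.adv e).isListen) &&
      isMsg (some (resolve ((List.finRange (n + 1)).filterMap (emit K s)))))

/-- Histories are lists of slots, the most recent slot first. -/
def know : List (Slot n b Φ) → Knowledge n
  | [] => ⟨fun d => decide (d = 0), false⟩
  | s :: h => (know h).update s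

/-- The number of correct nodes (Alice not included) that have received `m`. -/
def informedCount (h : List (Slot n b Φ)) : ℕ :=
  (Finset.univ.filter (fun v : Fin n => (know h).holds v.succ = true)).card

/-- The energy spent by a correct device: one unit for each slot of sending or listening. -/
def cost (h : List (Slot n b Φ)) (d : Fin (n + 1)) : ℕ :=
  h.countP (fun s => (s.act d).isActive)

/-- The energy spent by an adversarial device: one unit for each slot in which it is active. -/
def advCost (h : List (Slot n b Φ)) (e : Fin (b + 1)) : ℕ :=
  h.countP (fun s => (s.adv e).isActive)

/-- The number of slots in which the adversary attacks the channel. -/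
def attackedSlots (h : List (Slot n b Φ)) : ℕ :=
  h.countP (fun s => (List.finRange (b + 1)).any (fun e => (s.adv e).isAttack))

/-- In every slot of the history, the channel is mere noise for every correct device
(whether or not the device listens). -/
def ContinuouslyJammed (h : List (Slot n b Φ)) : Prop :=
  ∀ (s : Slot n b Φ) (h' : List (Slot n b Φ)), (s :: h') <:+ h →
    ∀ d, resolve (signalsAt (know h') s d) = .noise

/-! ### Algorithms, adversaries and executions -/

/-- What a device has seen: its own actions and receptions, the most recent slot first. -/
abbrev View (Φ : Type) : Type := List (Action Φ × Option (Heard Φ))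

def view : List (Slot n b Φ) → Fin (n + 1) → View Φ
  | [], _ => []
  | s :: h, d => (s.act d, heard (know h) s d) :: view h d

/-- A randomised distributed algorithm: each correct device draws its next action from a
distribution that is determined by what it has seen. -/
structure Algorithm (n : ℕ) (Φ : Type) : Type where
  act : Fin (n + 1) → View Φ → PMF (Action Φ)

/-- A strategy of Carol, who coordinates all her devices: adaptive (it depends on the whole past
of all devices), randomised, and not reactive (it does not see the current slot). -/
abbrev Strategy (n b : ℕ) (Φ : Type) : Type :=
  List (Slot n b Φ) → PMF (Fin (b + 1) → AdvAction n Φ)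

/-- Independent sampling. -/
def indep {α : Type} : (k : ℕ) → (Fin k → PMF α) → PMF (Fin k → α)
  | 0, _ => PMF.pure Fin.elim0
  | k + 1, q => (q 0).bind fun a => (indep k fun i => q i.succ).bind fun g =>
      PMF.pure (Fin.cons a g)

/-- An adversarial device that has exhausted its budget can only sleep. -/
def capped (budget : Fin (b + 1) → ℝ) (h : List (Slot n b Φ)) (x : Fin (b + 1) → AdvAction n Φ)
    (e : Fin (b + 1)) : AdvAction n Φ :=
  open Classical in if (advCost h e : ℝ) + 1 ≤ budget e then x e else .sleep

/-- The distribution of the history of the first `t` slots. -/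
def run (budget : Fin (b + 1) → ℝ) (A : Algorithm n Φ) (S : Strategy n b Φ) :
    ℕ → PMF (List (Slot n b Φ))
  | 0 => PMF.pure []
  | t + 1 => (run budget A S t).bind fun h =>
      (indep (n + 1) fun d => A.act d (view h d)).bind fun a =>
        (S h).bind fun x => PMF.pure (⟨a, capped budget h x⟩ :: h)

/-- The probability of an event. -/
def prob {α : Type} (p : PMF α) (E : α → Prop) : ENNReal := p.toOuterMeasure {x | E x}

/-- Carol has the budget `C √n ln n`, each Byzantine node has the budget `C √n`. -/
def advBudget (C : ℝ) (n b : ℕ) : Fin (b + 1) → ℝ :=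
  fun e => if e = 0 then C * Real.sqrt n * Real.log n else C * Real.sqrt n

/-- The number of Byzantine nodes. -/
def byz (f : ℝ) (n : ℕ) : ℕ := ⌊f * n⌋₊

/-! ### The broadcast protocol -/

/-- A coin that shows `true` with probability `p`, truncated to `[0, 1]`. -/
def coin (p : ℝ) : PMF Bool :=
  PMF.ofFintype
    (fun x => cond x (ENNReal.ofReal (max 0 (min 1 p))) (ENNReal.ofReal (1 - max 0 (min 1 p))))
    (by
      have h0 : (0 : ℝ) ≤ max 0 (min 1 p) := le_max_left _ _
      have h1 : max 0 (min 1 p) ≤ 1 := max_le zero_le_one (min_le_left _ _)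
      rw [Fintype.sum_bool]
      simp only [cond_true, cond_false]
      rw [← ENNReal.ofReal_add h0 (by linarith)]
      simp)

/-- The length `2 ^ (3 i / 2)`, rounded up, of each of the three phases of round `i`. -/
def phaseLen (i : ℕ) : ℕ := ⌈(2 : ℝ) ^ (3 * (i : ℝ) / 2)⌉₊

/-- The first slot of round `i`; rounds are numbered from `1`. -/
def roundStart (i : ℕ) : ℕ := ∑ j ∈ Finset.Ico 1 i, 3 * phaseLen j

/-- The round to which slot `t` belongs. -/
def roundOf (t : ℕ) : ℕ := Nat.findGreatest (fun i => roundStart i ≤ t) (t + 1)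

inductive Phase : Type
  | inform : Phase
  | propagation : Phase
  | request : Phase

/-- The phase to which slot `t` belongs. -/
def phaseOf (t : ℕ) : Phase :=
  match (t - roundStart (roundOf t)) / phaseLen (roundOf t) with
  | 0 => .inform
  | 1 => .propagation
  | _ => .request

/-- Slot `t` is the last one of its phase. -/
def lastOfPhase (t : ℕ) : Bool :=
  decide ((t - roundStart (roundOf t)) % phaseLen (roundOf t) + 1 = phaseLen (roundOf t))

/-- The termination test at the end of the request phase of round `i`, for a device that heard
`k` noisy slots in it. No device gives up in a round before `3 lg ln n`. -/
def quits (n : ℕ) (c : ℝ) (i k : ℕ) : Bool :=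
  open Classical in
  decide (3 * Real.logb 2 (Real.log n) ≤ (i : ℝ) ∧ (k : ℝ) ≤ 5 * c * Real.log n)

/-- Local state of Alice: active, with the number of noisy slots heard in the current request
phase, or terminated. -/
inductive AliceState : Type
  | active : ℕ → AliceState
  | done : AliceState

/-- Local state of a node: uninformed (with the number of noisy slots heard in the current request
phase), informed and due to send in the next propagation phase (or in the current one, if informed
before it started), or inactive. -/
inductive NodeState : Type
  | uninformed : ℕ → NodeState
  | informed : NodeState
  | done : NodeState

/-- The protocol has a single kind of frame besides `m`, namely `nack`. -/
abbrev nack : Frame Unit := .other ()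

/-- Alice's change of state at the end of slot `t`. -/
def aliceStep (n : ℕ) (c : ℝ) (t : ℕ) (r : Option (Heard Unit)) : AliceState → AliceState
  | .done => .done
  | .active k =>
      match phaseOf t with
      | .request =>
          let k' := if isNoisy r then k + 1 else k
          if lastOfPhase t then (if quits n c (roundOf t) k' then .done else .active 0)
          else .active k'
      | _ => .active k

/-- Alice's state at the start of a slot. -/
def aliceState (n : ℕ) (c : ℝ) : View Unit → AliceState
  | [] => .active 0
  | r :: w => aliceStep n c w.length r.2 (aliceState n c w)

/-- A node's change of state at the end of slot `t`. -/
def nodeStep (n : ℕ) (c : ℝ) (t : ℕ) (r : Option (Heard Unit)) : NodeState → NodeState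
  | .done => .done
  | .informed =>
      match phaseOf t with
      | .propagation => if lastOfPhase t then .done else .informed
      | _ => .informed
  | .uninformed k =>
      match phaseOf t with
      | .inform => if isMsg r then .informed else .uninformed k
      | .propagation => if isMsg r then .done else .uninformed k
      | .request =>
          if isMsg r then .informed else
          let k' := if isNoisy r then k + 1 else k
          if lastOfPhase t then (if quits n c (roundOf t) k' then .done else .uninformed 0)
          else .uninformed k'

/-- A node's state at the start of a slot. -/
def nodeState (n : ℕ) (c : ℝ) : View Unit → NodeState
  | [] => .uninformed 0
  | r :: w => nodeStep n c w.length r.2 (nodeState n c w)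

def sendWithProb (x : Frame Unit) (p : ℝ) : PMF (Action Unit) :=
  (coin p).map fun o => cond o (.send x) .sleep

def listenWithProb (p : ℝ) : PMF (Action Unit) :=
  (coin p).map fun o => cond o .listen .sleep

/-- Send with probability `p`, and independently listen with probability `q`;
a device that sends cannot listen in the same slot. -/
def sendOrListen (x : Frame Unit) (p q : ℝ) : PMF (Action Unit) :=
  (coin p).bind fun o => cond o (PMF.pure (.send x)) (listenWithProb q)

/-- Alice's action in slot `t`. -/
def aliceAct (n : ℕ) (ε' c : ℝ) (t : ℕ) : AliceState → PMF (Action Unit)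
  | .done => PMF.pure .sleep
  | .active _ =>
      match phaseOf t with
      | .inform => sendWithProb .msg (2 * Real.log n / 2 ^ roundOf t)
      | .propagation => PMF.pure .sleep
      | .request => listenWithProb
          (c * Real.log n /
            ((1 - Real.exp (-4 * ε')) * (2 : ℝ) ^ (3 * (roundOf t : ℝ) / 2)))

/-- A node's action in slot `t`. -/
def nodeAct (n : ℕ) (ε' c : ℝ) (t : ℕ) : NodeState → PMF (Action Unit)
  | .done => PMF.pure .sleep
  | .informed =>
      match phaseOf t with
      | .propagation => sendWithProb .msg (1 / n)
      | _ => PMF.pure .sleep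
  | .uninformed _ =>
      match phaseOf t with
      | .inform => listenWithProb (2 / (ε' * 2 ^ roundOf t))
      | .propagation => listenWithProb (4 * Real.exp 1 * (c + 1) / 2 ^ roundOf t)
      | .request => sendOrListen nack (1 / n)
          ((c + 1) / ((1 - Real.exp (-64 * ε')) * 2 ^ roundOf t))

/-- The broadcast protocol for `k = 2` (that is, `a = 1/2` and `b = 1`), with its two
constants `ε'` and `c`. -/
def protocol (n : ℕ) (ε' c : ℝ) : Algorithm n Unit where
  act d w :=
    if d = 0 then aliceAct n ε' c w.length (aliceState n c w)
    else nodeAct n ε' c w.length (nodeState n c w)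

end Jam

end

/-!
The total budget of the adversary is of the order of `n^{3/2}`: there are about `f n` Byzantine
nodes with `C √n` units each, and Carol's own `C √n ln n` is of lower order. If the Byzantine nodes
take turns, they jam about `f C n^{3/2}` slots in a row (`eventually_jamming`), and they can attack
no more slots than they have energy (`attackedSlots_le`). This settles the first two claims.

For the protocol, look at a round `I` in which `2 ^ I` is about `κ n` for a large constant `κ`. Each
of its phases is at least twice as long as the number of slots that the adversary can attack, and it
ends within `O(n^{3/2})` slots. If nobody has given up by then and the uninformed nodes are still
numerous (more than `ε n`), then
* in the inform phase, Alice sends in about `√n ln n` unattacked slots and in a constant fraction of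
  them some uninformed node listens, so that of the order of `√n ln n` nodes become relays
  (`prob_informFails_le`);
* in the propagation phase, with that many relays, a given uninformed node gets the message in an
  unattacked slot with a probability that is of the order of `(c + 1) ln n` when summed over the
  phase, so that with high probability no node remains uninformed (`prob_propagationFails_le`).

In earlier rounds the adversary may jam as she likes, but as long as the uninformed nodes are
numerous, their nacks make a constant fraction of the slots of every request phase noisy. Attacks
can only add noise, so whoever tests for termination hears many noisy slots and goes on
(`prob_aliceMisled_le`, `prob_nodeMisled_le`). The energy of each device is bounded by summing the
probabilities of being active, which decrease geometrically relative to the lengths of the rounds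
(`prob_cost_le`).

All these probabilities are estimated against an adaptive adversary. Her move in a slot depends on
the past but is independent of the moves of the correct devices in that slot, so it can be taken to
be fixed when the conditional probability of a success in that slot is computed. Hence the usual
exponential weights are supermartingales (`expect_run_le_one`), and Chernoff's bounds hold for
trials that are selected adaptively, in particular by the adversary's decision not to attack
(`prob_few_hits_le`, `prob_cost_ge_le`). That the absence of all these failures implies success is
a deterministic statement about histories (`le_informedCount_of_not_fails`).
-/

noncomputable section

namespace Jam

/-! ### Expectations over discrete distributions -/

/-- The expectation of a nonnegative function. -/
def expect {α : Type} (p : PMF α) (F : α → ENNReal) : ENNReal := ∑' a, p a * F a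

lemma expect_pure {α : Type} (a : α) (F : α → ENNReal) : expect (PMF.pure a) F = F a := by
  unfold expect
  rw [tsum_eq_single a]
  · simp
  · intro b hb; simp [hb]

lemma expect_bind {α β : Type} (p : PMF α) (q : α → PMF β) (F : β → ENNReal) :
    expect (p.bind q) F = expect p fun a => expect (q a) F := by
  unfold expect
  simp only [PMF.bind_apply, ← ENNReal.tsum_mul_right, ← ENNReal.tsum_mul_left]
  rw [ENNReal.tsum_comm]
  simp only [mul_assoc]

lemma expect_comm {α β : Type} (p : PMF α) (q : PMF β) (F : α → β → ENNReal) :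
    (expect p fun a => expect q fun b => F a b) = expect q fun b => expect p fun a => F a b := by
  unfold expect
  simp only [← ENNReal.tsum_mul_left]
  rw [ENNReal.tsum_comm]
  refine tsum_congr fun b => tsum_congr fun a => ?_
  ring

lemma expect_mono {α : Type} (p : PMF α) {F G : α → ENNReal} (h : ∀ a ∈ p.support, F a ≤ G a) :
    expect p F ≤ expect p G := by
  refine ENNReal.tsum_le_tsum fun a => ?_
  by_cases ha : p a = 0
  · simp [ha]
  · exact mul_le_mul_right (h a ((PMF.mem_support_iff _ _).2 ha)) _

lemma expect_const {α : Type} (p : PMF α) (c : ENNReal) : (expect p fun _ => c) = c := by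
  unfold expect
  rw [ENNReal.tsum_mul_right, p.tsum_coe, one_mul]

lemma expect_const_mul {α : Type} (p : PMF α) (c : ENNReal) (F : α → ENNReal) :
    (expect p fun a => c * F a) = c * expect p F := by
  unfold expect
  rw [← ENNReal.tsum_mul_left]
  refine tsum_congr fun a => ?_
  ring

lemma expect_add {α : Type} (p : PMF α) (F G : α → ENNReal) :
    (expect p fun a => F a + G a) = expect p F + expect p G := by
  unfold expect
  simp only [mul_add]
  exact ENNReal.tsum_add

lemma expect_sum {α ι : Type} (p : PMF α) (I : Finset ι) (F : ι → α → ENNReal) :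
    (expect p fun a => ∑ i ∈ I, F i a) = ∑ i ∈ I, expect p (F i) := by
  unfold expect
  simp only [Finset.mul_sum]
  exact Summable.tsum_finsetSum fun i _ => ENNReal.summable

open Classical in
lemma prob_eq_expect {α : Type} (p : PMF α) (E : α → Prop) :
    prob p E = expect p fun a => if E a then 1 else 0 := by
  unfold prob expect
  rw [PMF.toOuterMeasure_apply]
  refine tsum_congr fun a => ?_
  by_cases h : E a <;> simp [h]

lemma prob_mono {α : Type} (p : PMF α) {E F : α → Prop} (h : ∀ a ∈ p.support, E a → F a) :
    prob p E ≤ prob p F := by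
  classical
  rw [prob_eq_expect, prob_eq_expect]
  refine expect_mono p fun a ha => ?_
  by_cases hE : E a
  · simp [hE, h a ha hE]
  · simp [hE]

lemma prob_true {α : Type} (p : PMF α) : prob p (fun _ => True) = 1 := by
  rw [prob_eq_expect]; simp [expect_const]

lemma prob_le_one {α : Type} (p : PMF α) (E : α → Prop) : prob p E ≤ 1 :=
  (prob_mono p fun _ _ _ => trivial).trans (prob_true p).le

lemma prob_ne_top {α : Type} (p : PMF α) (E : α → Prop) : prob p E ≠ ⊤ :=
  ne_top_of_le_ne_top ENNReal.one_ne_top (prob_le_one p E)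

lemma prob_add_prob_not {α : Type} (p : PMF α) (E : α → Prop) :
    prob p E + prob p (fun a => ¬ E a) = 1 := by
  classical
  rw [prob_eq_expect, prob_eq_expect, ← expect_add, ← expect_const p 1]
  congr 1; funext a
  by_cases h : E a <;> simp [h, expect_const]

lemma prob_exists_le {α ι : Type} [Fintype ι] (p : PMF α) (E : ι → α → Prop) (δ : ENNReal)
    (h : ∀ i, prob p (E i) ≤ δ) : prob p (fun a => ∃ i, E i a) ≤ Fintype.card ι * δ := by
  classical
  calc prob p (fun a => ∃ i, E i a) ≤ ∑ i, prob p (E i) := by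
        simp only [prob_eq_expect]
        rw [← expect_sum]
        refine expect_mono p fun a _ => ?_
        by_cases ha : ∃ i, E i a
        · obtain ⟨i, hi⟩ := ha
          rw [if_pos ⟨i, hi⟩]
          refine le_trans ?_ (Finset.single_le_sum (fun _ _ => zero_le) (Finset.mem_univ i))
          simp [hi]
        · simp [ha]
    _ ≤ ∑ _i : ι, δ := Finset.sum_le_sum fun i _ => h i
    _ = _ := by simp

/-- Markov's inequality. -/
lemma prob_le_of_expect_le_one {α : Type} (p : PMF α) (W : α → ENNReal) (hW : expect p W ≤ 1)
    (E : α → Prop) (x : ℝ) (h : ∀ a ∈ p.support, E a → ENNReal.ofReal (Real.exp x) ≤ W a) :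
    prob p E ≤ ENNReal.ofReal (Real.exp (-x)) := by
  classical
  calc prob p E = expect p fun a => if E a then 1 else 0 := prob_eq_expect p E
    _ ≤ expect p fun a => ENNReal.ofReal (Real.exp (-x)) * W a := by
        refine expect_mono p fun a ha => ?_
        by_cases hE : E a
        · rw [if_pos hE]
          calc (1 : ENNReal) = ENNReal.ofReal (Real.exp (-x)) * ENNReal.ofReal (Real.exp x) := by
                rw [← ENNReal.ofReal_mul (Real.exp_pos _).le, ← Real.exp_add]; simp
            _ ≤ _ := mul_le_mul_right (h a ha hE) _
        · simp [hE]
    _ = ENNReal.ofReal (Real.exp (-x)) * expect p W := expect_const_mul _ _ _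
    _ ≤ ENNReal.ofReal (Real.exp (-x)) * 1 := mul_le_mul_right hW _
    _ = _ := mul_one _

/-- The probability of an event, as a real number. -/
def pr {α : Type} (p : PMF α) (E : α → Prop) : ℝ := (prob p E).toReal

lemma ofReal_pr {α : Type} (p : PMF α) (E : α → Prop) : ENNReal.ofReal (pr p E) = prob p E :=
  ENNReal.ofReal_toReal (prob_ne_top p E)

lemma pr_nonneg {α : Type} (p : PMF α) (E : α → Prop) : 0 ≤ pr p E := ENNReal.toReal_nonneg

lemma pr_le_one {α : Type} (p : PMF α) (E : α → Prop) : pr p E ≤ 1 :=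
  ENNReal.toReal_le_of_le_ofReal zero_le_one (by simpa using prob_le_one p E)

lemma pr_mono {α : Type} (p : PMF α) {E F : α → Prop} (h : ∀ a ∈ p.support, E a → F a) :
    pr p E ≤ pr p F :=
  ENNReal.toReal_mono (prob_ne_top p F) (prob_mono p h)

lemma pr_not {α : Type} (p : PMF α) (E : α → Prop) : pr p (fun a => ¬ E a) = 1 - pr p E := by
  have h := congrArg ENNReal.toReal (prob_add_prob_not p E)
  rw [ENNReal.toReal_add (prob_ne_top _ _) (prob_ne_top _ _)] at h
  simp only [ENNReal.toReal_one] at h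
  unfold pr; linarith

lemma pr_pure {α : Type} (a : α) (E : α → Prop) [Decidable (E a)] :
    pr (PMF.pure a) E = if E a then 1 else 0 := by
  unfold pr
  rw [prob_eq_expect, expect_pure]
  by_cases h : E a <;> simp [h]

/-- The expectation of a function with two values. -/
lemma expect_ite {α : Type} (p : PMF α) (E : α → Prop) [DecidablePred E]
    {x y : ℝ} (hx : 0 ≤ x) (hy : 0 ≤ y) :
    (expect p fun a => if E a then ENNReal.ofReal x else ENNReal.ofReal y) =
      ENNReal.ofReal (x * pr p E + y * (1 - pr p E)) := by
  rw [ENNReal.ofReal_add (mul_nonneg hx (pr_nonneg _ _))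
      (mul_nonneg hy (sub_nonneg.2 (pr_le_one _ _))), ENNReal.ofReal_mul hx, ENNReal.ofReal_mul hy,
    ← pr_not, ofReal_pr, ofReal_pr, prob_eq_expect, prob_eq_expect, ← expect_const_mul,
    ← expect_const_mul, ← expect_add]
  classical
  congr 1; funext a
  by_cases h : E a <;> simp [h]

/-! ### Independent sampling -/

lemma expect_indep_prod {α : Type} : (k : ℕ) → (q : Fin k → PMF α) →
    (F : Fin k → α → ENNReal) →
    (expect (indep k q) fun a => ∏ i, F i (a i)) = ∏ i, expect (q i) (F i)
  | 0, q, F => by simp [expect_const]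
  | k + 1, q, F => by
      unfold indep
      simp only [expect_bind, expect_pure, Fin.prod_univ_succ, Fin.cons_zero, Fin.cons_succ,
        expect_const_mul]
      rw [expect_indep_prod k (fun i => q i.succ) fun i => F i.succ]
      simp only [mul_comm _ (∏ i : Fin k, expect (q i.succ) (F i.succ)), expect_const_mul]

lemma mem_support_indep {α : Type} : {k : ℕ} → {q : Fin k → PMF α} → {a : Fin k → α} →
    a ∈ (indep k q).support → ∀ i, a i ∈ (q i).support
  | 0, _, _, _, i => i.elim0
  | k + 1, q, a, h, i => by
      unfold indep at h
      simp only [PMF.mem_support_bind_iff, PMF.mem_support_pure_iff] at h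
      obtain ⟨x, hx, g, hg, rfl⟩ := h
      refine Fin.cases ?_ (fun j => ?_) i
      · simpa using hx
      · simpa using mem_support_indep hg j

/-- The probability of a box is the product of the probabilities of its sides. -/
lemma pr_indep_forall {α : Type} (k : ℕ) (q : Fin k → PMF α) (E : Fin k → α → Prop) :
    pr (indep k q) (fun a => ∀ i, E i (a i)) = ∏ i, pr (q i) (E i) := by
  classical
  unfold pr
  rw [← ENNReal.toReal_prod]
  congr 1
  simp only [prob_eq_expect]
  rw [← expect_indep_prod]
  congr 1; funext a
  by_cases h : ∀ i, E i (a i)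
  · simp [h]
  · rw [if_neg h]
    push Not at h
    obtain ⟨i, hi⟩ := h
    exact (Finset.prod_eq_zero (Finset.mem_univ i) (by simp [hi])).symm

lemma pr_true {α : Type} (p : PMF α) : pr p (fun _ => True) = 1 := by simp [pr, prob_true]

lemma pr_indep_single {α : Type} (k : ℕ) (q : Fin k → PMF α) (i : Fin k) (E : α → Prop) :
    pr (indep k q) (fun a => E (a i)) = pr (q i) E := by
  classical
  have h := pr_indep_forall k q (fun j x => j = i → E x)
  rw [Finset.prod_eq_single i] at h
  · simpa using h
  · intro j _ hj; simp [hj, pr_true]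
  · simp

/-- Independent events, one on the coordinate `d` and one on each coordinate in `U`. -/
lemma pr_indep_and_forall {α : Type} {k : ℕ} (q : Fin k → PMF α) {d : Fin k} {U : Finset (Fin k)}
    (hd : d ∉ U) (E : α → Prop) (F : Fin k → α → Prop) :
    pr (indep k q) (fun a => E (a d) ∧ ∀ u ∈ U, F u (a u)) =
      pr (q d) E * ∏ u ∈ U, pr (q u) (F u) := by
  classical
  have h := pr_indep_forall k q (fun j x => (j = d → E x) ∧ (j ∈ U → F j x))
  have h1 : ∏ j, pr (q j) (fun x => (j = d → E x) ∧ (j ∈ U → F j x)) =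
      ∏ j ∈ insert d U, pr (q j) (fun x => (j = d → E x) ∧ (j ∈ U → F j x)) := by
    symm
    apply Finset.prod_subset (Finset.subset_univ _)
    intro j _ hj
    rw [Finset.mem_insert, not_or] at hj
    simp [hj.1, hj.2, pr_true]
  rw [h1, Finset.prod_insert hd] at h
  convert h using 2
  · funext a
    refine propext ⟨fun ⟨h1, h2⟩ j => ⟨fun hj => hj ▸ h1, h2 j⟩, fun H =>
      ⟨(H d).1 rfl, fun u hu => (H u).2 hu⟩⟩
  · simp [hd]
  · refine Finset.prod_congr rfl fun u hu => ?_
    have : u ≠ d := fun h => hd (h ▸ hu)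
    simp [this, hu]

lemma pr_and_eq_sub {α : Type} (p : PMF α) (E F : α → Prop) :
    pr p (fun a => E a ∧ F a) = pr p E - pr p (fun a => E a ∧ ¬ F a) := by
  classical
  have h : prob p E = prob p (fun a => E a ∧ F a) + prob p (fun a => E a ∧ ¬ F a) := by
    rw [prob_eq_expect, prob_eq_expect, prob_eq_expect, ← expect_add]
    congr 1; funext a
    by_cases h : E a <;> by_cases h' : F a <;> simp [h, h']
  have h2 := congrArg ENNReal.toReal h
  rw [ENNReal.toReal_add (prob_ne_top _ _) (prob_ne_top _ _)] at h2
  unfold pr; linarith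

/-- The coordinate `d` is in `E`, and some coordinate in `U` is in `F`. -/
lemma le_pr_indep_and_exists {α : Type} {k : ℕ} (q : Fin k → PMF α) {d : Fin k}
    {U : Finset (Fin k)} (hd : d ∉ U) (E F : α → Prop) {x y : ℝ}
    (hx : x ≤ pr (q d) E) (hy : ∀ u ∈ U, y ≤ pr (q u) F) (hy1 : y ≤ 1)
    (hy0 : 0 ≤ y) :
    x * (1 - (1 - y) ^ U.card) ≤ pr (indep k q) (fun a => E (a d) ∧ ∃ u ∈ U, F (a u)) := by
  have h := pr_and_eq_sub (indep k q) (fun a => E (a d)) (fun a => ∃ u ∈ U, F (a u))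
  rw [h, pr_indep_single k q d E]
  have h2 := pr_indep_and_forall q hd E (fun _ x => ¬ F x)
  push Not
  rw [h2]
  have h3 : ∏ u ∈ U, pr (q u) (fun x => ¬ F x) ≤ (1 - y) ^ U.card := by
    rw [← Finset.prod_const]
    refine Finset.prod_le_prod (fun u _ => pr_nonneg _ _) fun u hu => ?_
    rw [pr_not]; linarith [hy u hu]
  have h4 : (1 - y) ^ U.card ≤ 1 := pow_le_one₀ (by linarith) (by linarith)
  have h5 := pr_nonneg (q d) E
  nlinarith [mul_le_mul_of_nonneg_left h3 h5, mul_le_mul_of_nonneg_right hx (sub_nonneg.2 h4)]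

/-- The coordinate `d` is in `E`, and exactly one coordinate in `I` is in `F`. -/
lemma le_pr_indep_and_existsUnique {α : Type} {k : ℕ} (q : Fin k → PMF α) {d : Fin k}
    {I : Finset (Fin k)} (hd : d ∉ I) (E F : α → Prop) {y : ℝ}
    (hy : ∀ u ∈ I, pr (q u) F = y) :
    pr (q d) E * (I.card * (y * (1 - y) ^ (I.card - 1))) ≤
      pr (indep k q) (fun a => E (a d) ∧ ∃ w ∈ I, F (a w) ∧ ∀ u ∈ I, u ≠ w → ¬ F (a u)) := by
  classical
  have h1 : ∀ w ∈ I, pr (indep k q) (fun a => E (a d) ∧ ∀ u ∈ I, (u = w ↔ F (a u))) =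
      pr (q d) E * (y * (1 - y) ^ (I.card - 1)) := by
    intro w hw
    rw [pr_indep_and_forall q hd E (fun u x => (u = w ↔ F x))]
    congr 1
    rw [← Finset.mul_prod_erase I _ hw]
    congr 1
    · simpa using hy w hw
    · rw [← Finset.card_erase_of_mem hw, ← Finset.prod_const]
      refine Finset.prod_congr rfl fun u hu => ?_
      rw [Finset.mem_erase] at hu
      simp only [hu.1, false_iff]
      rw [pr_not, hy u hu.2]
  have h2 : ∑ w ∈ I, prob (indep k q) (fun a => E (a d) ∧ ∀ u ∈ I, (u = w ↔ F (a u))) ≤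
      prob (indep k q) (fun a => E (a d) ∧ ∃ w ∈ I, F (a w) ∧ ∀ u ∈ I, u ≠ w → ¬ F (a u)) := by
    simp only [prob_eq_expect]
    rw [← expect_sum]
    refine expect_mono _ fun a _ => ?_
    by_cases hex : ∃ w ∈ I, E (a d) ∧ ∀ u ∈ I, (u = w ↔ F (a u))
    · obtain ⟨w, hw, hE, hwu⟩ := hex
      rw [Finset.sum_eq_single w]
      · rw [if_pos ⟨hE, hwu⟩, if_pos ⟨hE, w, hw, (hwu w hw).1 rfl, fun u hu hne hF =>
          hne ((hwu u hu).2 hF)⟩]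
      · intro w' hw' hne
        rw [if_neg]
        rintro ⟨-, h⟩
        exact hne ((hwu w' hw').2 ((h w' hw').1 rfl))
      · exact fun h => absurd hw h
    · rw [Finset.sum_eq_zero]
      · exact zero_le
      · intro w hw
        rw [if_neg fun h => hex ⟨w, hw, h⟩]
  have h3 := ENNReal.toReal_mono (prob_ne_top _ _) h2
  rw [ENNReal.toReal_sum fun _ _ => prob_ne_top _ _] at h3
  refine le_trans (le_of_eq ?_) h3
  change _ = ∑ w ∈ I, pr (indep k q) fun a => E (a d) ∧ ∀ u ∈ I, (u = w ↔ F (a u))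
  rw [Finset.sum_congr rfl h1]
  simp; ring

/-! ### Executions and adaptive concentration bounds -/

variable {n b : ℕ} {Φ : Type}

lemma mem_support_run_succ {budget : Fin (b + 1) → ℝ} {A : Algorithm n Φ} {S : Strategy n b Φ}
    {t : ℕ} {h : List (Slot n b Φ)} (hh : h ∈ (run budget A S (t + 1)).support) :
    ∃ h' ∈ (run budget A S t).support, ∃ a, ∃ x ∈ (S h').support,
      h = ⟨a, capped budget h' x⟩ :: h' := by
  simp only [run, PMF.mem_support_bind_iff, PMF.mem_support_pure_iff] at hh
  obtain ⟨h', h1, a, _, x, h3, h4⟩ := hh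
  exact ⟨h', h1, a, x, h3, h4⟩

lemma length_of_mem_support {budget : Fin (b + 1) → ℝ} {A : Algorithm n Φ} {S : Strategy n b Φ} :
    ∀ {t : ℕ} {h : List (Slot n b Φ)}, h ∈ (run budget A S t).support → h.length = t
  | 0, h, hh => by
      simp only [run, PMF.mem_support_pure_iff] at hh
      simp [hh]
  | t + 1, h, hh => by
      obtain ⟨h', h1, a, x, -, rfl⟩ := mem_support_run_succ hh
      simp [length_of_mem_support h1]

/-- A function of the history whose conditional expectation does not increase in any slot,
whatever the adversary does in that slot, has expectation at most its initial value. The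
adversary's moves and the devices' moves in one slot are independent, so that her move can be
taken to be fixed. -/
lemma expect_run_le_one (budget : Fin (b + 1) → ℝ) (A : Algorithm n Φ) (S : Strategy n b Φ)
    (W : List (Slot n b Φ) → ENNReal) (h0 : W [] ≤ 1)
    (hstep : ∀ (h : List (Slot n b Φ)) (y : Fin (b + 1) → AdvAction n Φ),
      (expect (indep (n + 1) fun d => A.act d (view h d)) fun a => W (⟨a, y⟩ :: h)) ≤ W h) :
    ∀ t, expect (run budget A S t) W ≤ 1
  | 0 => by simpa [run, expect_pure] using h0
  | t + 1 => by
      refine le_trans ?_ (expect_run_le_one budget A S W h0 hstep t)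
      simp only [run, expect_bind, expect_pure]
      refine expect_mono _ fun h _ => ?_
      rw [expect_comm]
      calc _ ≤ expect (S h) fun _ => W h := expect_mono _ fun x _ => hstep h (capped budget h x)
        _ = W h := expect_const _ _

open Classical in
/-- The number of slots of the history with the property `P`, which may refer to the slot and to
the history before it. -/
def countSlots (P : Slot n b Φ → List (Slot n b Φ) → Prop) : List (Slot n b Φ) → ℕ
  | [] => 0
  | s :: h => countSlots P h + if P s h then 1 else 0

/-- Chernoff's lower tail bound for adaptive trials: a trial takes place in every slot in which
the past and the adversary's move satisfy `act`, and each trial succeeds with a conditional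
probability of at least `p`. -/
theorem prob_few_hits_le (budget : Fin (b + 1) → ℝ) (A : Algorithm n Φ) (S : Strategy n b Φ)
    (act : (Fin (b + 1) → AdvAction n Φ) → List (Slot n b Φ) → Prop)
    (hit : Slot n b Φ → List (Slot n b Φ) → Prop) {p : ℝ} (hp : 0 ≤ p)
    (H : ∀ h y, act y h →
      p ≤ pr (indep (n + 1) fun d => A.act d (view h d)) fun a => hit ⟨a, y⟩ h)
    (N k : ℝ) (t : ℕ) :
    prob (run budget A S t) (fun h => N ≤ countSlots (fun s h => act s.adv h) h ∧
        (countSlots (fun s h => act s.adv h ∧ hit s h) h : ℝ) ≤ k) ≤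
      ENNReal.ofReal (Real.exp (k - p * N / 2)) := by
  classical
  set W : List (Slot n b Φ) → ENNReal := fun h => ENNReal.ofReal (Real.exp
    (p / 2 * countSlots (fun s h => act s.adv h) h -
      countSlots (fun s h => act s.adv h ∧ hit s h) h)) with hW
  have hE : expect (run budget A S t) W ≤ 1 := by
    refine expect_run_le_one budget A S W (by simp [hW, countSlots]) (fun h y => ?_) t
    by_cases hy : act y h
    · have h1 : ∀ a, W (⟨a, y⟩ :: h) = W h * (if hit ⟨a, y⟩ h
          then ENNReal.ofReal (Real.exp (p / 2 - 1)) else ENNReal.ofReal (Real.exp (p / 2))) := by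
        intro a
        by_cases ha : hit ⟨a, y⟩ h
        · simp only [hW, countSlots, hy, ha, if_true, and_self]
          rw [← ENNReal.ofReal_mul (Real.exp_pos _).le, ← Real.exp_add]
          congr 2; push_cast; ring
        · simp only [hW, countSlots, hy, ha, if_true, if_false, and_false]
          rw [← ENNReal.ofReal_mul (Real.exp_pos _).le, ← Real.exp_add]
          congr 2; push_cast; ring
      simp only [h1, expect_const_mul]
      rw [expect_ite _ _ (Real.exp_pos _).le (Real.exp_pos _).le]
      refine mul_le_of_le_one_right zero_le ?_
      rw [← ENNReal.ofReal_one]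
      refine ENNReal.ofReal_le_ofReal ?_
      set P := pr (indep (n + 1) fun d => A.act d (view h d)) fun a => hit ⟨a, y⟩ h
      have hP : p ≤ P := H h y hy
      have he : Real.exp (-1) ≤ 1 / 2 := by
        rw [Real.exp_neg, inv_le_comm₀ (Real.exp_pos _) (by norm_num)]
        have := Real.add_one_le_exp 1
        linarith
      have h2 : Real.exp (p / 2) * (1 - p / 2) ≤ 1 := by
        have h3 := Real.add_one_le_exp (-(p / 2))
        have h4 : Real.exp (p / 2) * Real.exp (-(p / 2)) = 1 := by rw [← Real.exp_add]; simp
        nlinarith [Real.exp_pos (p / 2)]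
      have hs : Real.exp (p / 2 - 1) = Real.exp (p / 2) * Real.exp (-1) := by
        rw [← Real.exp_add]; ring_nf
      rw [hs]
      have h5 : Real.exp (-1) * P + (1 - P) ≤ 1 - p / 2 := by nlinarith
      nlinarith [Real.exp_pos (p / 2)]
    · have h1 : ∀ a, W (⟨a, y⟩ :: h) = W h := by
        intro a; simp [hW, countSlots, hy]
      simp [h1, expect_const]
  have := prob_le_of_expect_le_one (run budget A S t) W hE
    (fun h => N ≤ countSlots (fun s h => act s.adv h) h ∧
        (countSlots (fun s h => act s.adv h ∧ hit s h) h : ℝ) ≤ k) (p * N / 2 - k) ?_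
  · simpa using this
  · rintro h - ⟨h1, h2⟩
    refine ENNReal.ofReal_le_ofReal (Real.exp_le_exp.2 ?_)
    nlinarith

/-- Chernoff's upper tail bound for the energy that a correct device spends. -/
theorem prob_cost_ge_le (budget : Fin (b + 1) → ℝ) (A : Algorithm n Φ) (S : Strategy n b Φ)
    (d : Fin (n + 1)) (q : ℕ → ℝ)
    (H : ∀ h : List (Slot n b Φ),
      pr (A.act d (view h d)) (fun x => x.isActive = true) ≤ q h.length) (k : ℝ) (t : ℕ) :
    prob (run budget A S t) (fun h => k ≤ cost h d) ≤
      ENNReal.ofReal (Real.exp (2 * ∑ j ∈ Finset.range t, q j - k)) := by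
  classical
  set W : List (Slot n b Φ) → ENNReal := fun h => ENNReal.ofReal (Real.exp
    (cost h d - 2 * ∑ j ∈ Finset.range h.length, q j)) with hW
  have hE : expect (run budget A S t) W ≤ 1 := by
    refine expect_run_le_one budget A S W (by simp [hW, cost]) (fun h y => ?_) t
    have h1 : ∀ a : Fin (n + 1) → Action Φ, W (⟨a, y⟩ :: h) = W h * (if (a d).isActive = true
          then ENNReal.ofReal (Real.exp (1 - 2 * q h.length))
          else ENNReal.ofReal (Real.exp (- 2 * q h.length))) := by
      intro a
      by_cases ha : (a d).isActive = true
      · simp only [hW, cost, List.countP_cons, ha, if_true, List.length_cons,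
          Finset.sum_range_succ]
        rw [← ENNReal.ofReal_mul (Real.exp_pos _).le, ← Real.exp_add]
        congr 2; push_cast; ring
      · simp only [hW, cost, List.countP_cons, ha, List.length_cons,
          Finset.sum_range_succ, Bool.false_eq_true, if_false]
        rw [← ENNReal.ofReal_mul (Real.exp_pos _).le, ← Real.exp_add]
        congr 2; push_cast; ring
    simp only [h1, expect_const_mul]
    rw [expect_ite _ (fun a : Fin (n + 1) → Action Φ => (a d).isActive = true)
      (Real.exp_pos _).le (Real.exp_pos _).le]
    refine mul_le_of_le_one_right zero_le ?_
    rw [← ENNReal.ofReal_one]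
    refine ENNReal.ofReal_le_ofReal ?_
    rw [pr_indep_single (n + 1) (fun d => A.act d (view h d)) d
      fun x : Action Φ => x.isActive = true]
    set P := pr (A.act d (view h d)) fun x => x.isActive = true
    have hP : P ≤ q h.length := H h
    have hP0 : 0 ≤ P := pr_nonneg _ _
    set z := q h.length
    have he : Real.exp 1 ≤ 3 := by linarith [Real.exp_one_lt_d9]
    have h2 : Real.exp (-2 * z) * (1 + 2 * z) ≤ 1 := by
      have h3 := Real.add_one_le_exp (2 * z)
      have h4 : Real.exp (-2 * z) * Real.exp (2 * z) = 1 := by rw [← Real.exp_add]; simp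
      nlinarith [Real.exp_pos (-2 * z)]
    have hs : Real.exp (1 - 2 * z) = Real.exp (-2 * z) * Real.exp 1 := by
      rw [← Real.exp_add]; ring_nf
    rw [hs]
    have h5 : Real.exp 1 * P + (1 - P) ≤ 1 + 2 * z := by nlinarith
    nlinarith [Real.exp_pos (-2 * z)]
  have := prob_le_of_expect_le_one (run budget A S t) W hE (fun h => k ≤ cost h d)
    (k - 2 * ∑ j ∈ Finset.range t, q j) ?_
  · simpa using this
  · intro h hh h1
    refine ENNReal.ofReal_le_ofReal (Real.exp_le_exp.2 ?_)
    rw [length_of_mem_support hh]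
    linarith

end Jam

namespace Jam

/-! ### Continuous jamming -/

variable {n b : ℕ} {Φ : Type}

lemma resolve_eq_noise_of_mem {l : List (Signal Φ)} (h : Signal.noise ∈ l) :
    resolve l = .noise := by
  match l, h with
  | [.frame x], h => simp at h
  | [.noise], _ => rfl
  | a :: b :: l, _ => cases a <;> rfl

lemma holds_of_continuouslyJammed : ∀ {h : List (Slot n b Φ)}, ContinuouslyJammed h →
    ∀ d, (know h).holds d = decide (d = 0)
  | [], _, d => rfl
  | s :: h, H, d => by
      have h1 : ContinuouslyJammed h := fun s' h' hs => H s' h' (hs.trans (List.suffix_cons s h))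
      have h2 := H s h (List.suffix_refl _) d
      have h3 : isMsg (heard (know h) s d) = false := by
        unfold heard
        cases s.act d <;> simp [isMsg, h2]
      change ((know h).holds d || isMsg (heard (know h) s d)) = _
      rw [h3, Bool.or_false, holds_of_continuouslyJammed h1 d]

lemma informedCount_eq_zero_of_continuouslyJammed {h : List (Slot n b Φ)}
    (H : ContinuouslyJammed h) : informedCount h = 0 := by
  simp [informedCount, holds_of_continuouslyJammed H]

/-- The Byzantine nodes take turns: each of them jams every correct device for `m` slots, while
all the other adversarial devices sleep. -/
def jamInTurns (n b : ℕ) (Φ : Type) (m : ℕ) : Strategy n b Φ := fun h =>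
  PMF.pure fun e => if (e : ℕ) = h.length / m + 1 then .attack fun _ => some .noise else .sleep

lemma continuouslyJammed_jamInTurns {budget : Fin (b + 1) → ℝ} {m : ℕ}
    (hb : ∀ e, e ≠ 0 → (m : ℝ) ≤ budget e) (A : Algorithm n Φ) :
    ∀ t, t ≤ b * m → ∀ h ∈ (run budget A (jamInTurns n b Φ m) t).support,
      ContinuouslyJammed h ∧ ∀ e : Fin (b + 1), e ≠ 0 → advCost h e ≤ t - (e - 1) * m
  | 0, _, h, hh => by
      simp only [run, PMF.mem_support_pure_iff] at hh
      subst hh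
      exact ⟨fun s h' hs => by simp at hs, fun e _ => by simp [advCost]⟩
  | t + 1, ht, h, hh => by
      obtain ⟨h', h1, a, x, hx, rfl⟩ := mem_support_run_succ hh
      obtain ⟨hj, hc⟩ := continuouslyJammed_jamInTurns hb A t (by omega) h' h1
      have hl := length_of_mem_support h1
      simp only [jamInTurns, PMF.mem_support_pure_iff] at hx
      rw [hl] at hx
      have hm : 0 < m := Nat.pos_of_ne_zero fun h0 => by simp [h0] at ht
      have hlt : t / m < b := Nat.div_lt_of_lt_mul (by rw [mul_comm]; omega)
      have hdm := Nat.div_add_mod t m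
      have hmod := Nat.mod_lt t hm
      -- the device whose turn it is has spent at most `t % m` so far
      set e0 : Fin (b + 1) := ⟨t / m + 1, by omega⟩ with he0
      have he00 : e0 ≠ 0 := by simp [he0, Fin.ext_iff]
      have hcap : capped budget h' x e0 = .attack fun _ => some .noise := by
        have hle : (advCost h' e0 : ℝ) + 1 ≤ budget e0 := by
          refine le_trans ?_ (hb e0 he00)
          have := hc e0 he00
          have h2 : advCost h' e0 + 1 ≤ m := by
            have h3 : t - (t / m) * m = t % m := by
              rw [mul_comm]; omega
            simp only [he0, Nat.add_sub_cancel] at this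
            simp only [he0]
            omega
          exact_mod_cast h2
        rw [capped, if_pos hle, hx]
        simp [he0]
      have hoth : ∀ e : Fin (b + 1), (e : ℕ) ≠ t / m + 1 → capped budget h' x e = .sleep := by
        intro e he
        simp [capped, hx, he]
      refine ⟨fun s h'' hs d => ?_, fun e he => ?_⟩
      · rcases List.suffix_cons_iff.1 hs with h2 | h2
        · obtain ⟨rfl, rfl⟩ := List.cons.inj h2
          refine resolve_eq_noise_of_mem ?_
          refine List.mem_append_right _ (List.mem_filterMap.2 ⟨e0, List.mem_finRange _, ?_⟩)
          simp [emitAdv, hcap]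
        · exact hj s h'' h2 d
      · have h2 := hc e he
        by_cases hee : (e : ℕ) = t / m + 1
        · have h3 : advCost (⟨a, capped budget h' x⟩ :: h') e ≤ advCost h' e + 1 := by
            simp only [advCost, List.countP_cons]; split_ifs <;> omega
          have h4 : (e - 1 : ℕ) * m ≤ t := by
            rw [hee, Nat.add_sub_cancel, mul_comm]; omega
          omega
        · have h3 : advCost (⟨a, capped budget h' x⟩ :: h') e = advCost h' e := by
            simp [advCost, hoth e hee, AdvAction.isActive]
          omega

/-! ### The budget of the adversary -/

lemma advCost_le {budget : Fin (b + 1) → ℝ} (hb : ∀ e, 0 ≤ budget e) {A : Algorithm n Φ}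
    {S : Strategy n b Φ} : ∀ {t : ℕ} {h : List (Slot n b Φ)}, h ∈ (run budget A S t).support →
    ∀ e, (advCost h e : ℝ) ≤ budget e
  | 0, h, hh, e => by
      simp only [run, PMF.mem_support_pure_iff] at hh
      simp [hh, advCost, hb e]
  | t + 1, h, hh, e => by
      obtain ⟨h', h1, a, x, -, rfl⟩ := mem_support_run_succ hh
      have h2 := advCost_le hb h1 e
      by_cases hle : (advCost h' e : ℝ) + 1 ≤ budget e
      · refine le_trans ?_ hle
        have : advCost (⟨a, capped budget h' x⟩ :: h') e ≤ advCost h' e + 1 := by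
          simp only [advCost, List.countP_cons]; split_ifs <;> omega
        exact_mod_cast this
      · have hsl : capped budget h' x e = .sleep := if_neg hle
        have : advCost (⟨a, capped budget h' x⟩ :: h') e = advCost h' e := by
          simp [advCost, hsl, AdvAction.isActive]
        rw [this]; exact h2

/-- Some adversarial device attacks. -/
def Attacked (y : Fin (b + 1) → AdvAction n Φ) : Prop := ∃ e, (y e).isAttack = true

lemma attackedSlots_le_sum_advCost : ∀ h : List (Slot n b Φ),
    attackedSlots h ≤ ∑ e, advCost h e
  | [] => by simp [attackedSlots]
  | s :: h => by
      have ih := attackedSlots_le_sum_advCost h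
      have h1 : ∑ e, advCost (s :: h) e =
          ∑ e, advCost h e + ∑ e, if (s.adv e).isActive = true then 1 else 0 := by
        rw [← Finset.sum_add_distrib]
        simp [advCost, List.countP_cons]
      rw [h1]
      by_cases hs : Attacked s.adv
      · obtain ⟨e, he⟩ := hs
        have he' : (s.adv e).isActive = true := by
          revert he; cases s.adv e <;> simp [AdvAction.isAttack, AdvAction.isActive]
        have h2 : 1 ≤ ∑ e, if (s.adv e).isActive = true then 1 else 0 := by
          refine le_trans ?_ (Finset.single_le_sum (fun _ _ => Nat.zero_le _) (Finset.mem_univ e))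
          simp [he']
        have h3 : attackedSlots (s :: h) ≤ attackedSlots h + 1 := by
          simp only [attackedSlots, List.countP_cons]; split_ifs <;> omega
        omega
      · have h3 : attackedSlots (s :: h) = attackedSlots h := by
          simp only [Attacked, not_exists] at hs
          simp [attackedSlots, hs]
        omega

lemma rpow_three_halves (x : ℝ) (hx : 0 ≤ x) : x ^ (3 / 2 : ℝ) = x * Real.sqrt x := by
  rw [show (3 / 2 : ℝ) = 1 + 1 / 2 by norm_num, Real.rpow_add_of_nonneg hx (by norm_num)
    (by norm_num), Real.rpow_one, ← Real.sqrt_eq_rpow]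

/-- The total energy of the adversary is `O(n^{3/2})`. -/
lemma attackedSlots_le {f C : ℝ} (hf : 0 < f) (hC : 0 < C) (n : ℕ)
    (S : Strategy n (byz f n) Φ) (A : Algorithm n Φ) (t : ℕ)
    {h : List (Slot n (byz f n) Φ)} (hh : h ∈ (run (advBudget C n (byz f n)) A S t).support) :
    (attackedSlots h : ℝ) ≤ C * (1 + f) * (n * Real.sqrt n) := by
  have hlog : 0 ≤ Real.log n := Real.log_natCast_nonneg n
  have hb : ∀ e, 0 ≤ advBudget C n (byz f n) e := by
    intro e; unfold advBudget; split_ifs <;> positivity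
  have h1 : (attackedSlots h : ℝ) ≤ ∑ e, (advCost h e : ℝ) := by
    exact_mod_cast attackedSlots_le_sum_advCost h
  refine h1.trans ((Finset.sum_le_sum fun e _ => advCost_le hb hh e).trans ?_)
  rw [Fin.sum_univ_succ]
  have h2 : ∀ i : Fin (byz f n), advBudget C n (byz f n) i.succ = C * Real.sqrt n := by
    intro i; simp [advBudget, Fin.succ_ne_zero]
  simp only [h2, Finset.sum_const, Finset.card_univ, Fintype.card_fin, nsmul_eq_mul]
  have h3 : (byz f n : ℝ) ≤ f * n := Nat.floor_le (by positivity)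
  have h4 : Real.log n ≤ n := Real.log_le_self (Nat.cast_nonneg n)
  have h5 : advBudget C n (byz f n) 0 = C * Real.sqrt n * Real.log n := by simp [advBudget]
  rw [h5]
  have h6 : 0 ≤ C * Real.sqrt n := by positivity
  nlinarith [mul_le_mul_of_nonneg_left h4 h6, mul_le_mul_of_nonneg_left h3 h6]

lemma eventually_jamming {f C : ℝ} (hf : 0 < f) (hC : 0 < C) : ∀ᶠ n : ℕ in atTop, ∀ Φ : Type,
    ∃ S : Strategy n (byz f n) Φ, ∀ A : Algorithm n Φ, ∀ t : ℕ,
      (t : ℝ) ≤ f * C / 4 * (n : ℝ) ^ (3 / 2 : ℝ) →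
      ∀ h ∈ (run (advBudget C n (byz f n)) A S t).support,
        ContinuouslyJammed h ∧ informedCount h = 0 := by
  have hsq : Tendsto (fun n : ℕ => Real.sqrt n) atTop atTop :=
    Real.tendsto_sqrt_atTop.comp tendsto_natCast_atTop_atTop
  filter_upwards [tendsto_natCast_atTop_atTop.eventually_ge_atTop (2 / f),
    hsq.eventually_ge_atTop (2 / C)] with n h1 h2 Φ
  rw [div_le_iff₀ hf] at h1
  rw [div_le_iff₀ hC] at h2
  refine ⟨jamInTurns n (byz f n) Φ ⌊C * Real.sqrt n⌋₊, fun A t ht h hh => ?_⟩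
  have hm := Nat.lt_floor_add_one (C * Real.sqrt n)
  have hbz := Nat.lt_floor_add_one (f * n)
  have hle : t ≤ byz f n * ⌊C * Real.sqrt n⌋₊ := by
    rw [rpow_three_halves _ (Nat.cast_nonneg n)] at ht
    have h3 : f * n / 2 ≤ (byz f n : ℝ) := by unfold byz; linarith
    have h4 : C * Real.sqrt n / 2 ≤ (⌊C * Real.sqrt n⌋₊ : ℝ) := by linarith
    have h5 : (f * n / 2) * (C * Real.sqrt n / 2) ≤ (byz f n : ℝ) * ⌊C * Real.sqrt n⌋₊ :=
      mul_le_mul h3 h4 (by positivity) (by positivity)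
    have h6 : (t : ℝ) ≤ (byz f n : ℝ) * ⌊C * Real.sqrt n⌋₊ := by linarith
    exact_mod_cast h6
  have hj := (continuouslyJammed_jamInTurns (fun e he => ?_) A t hle h hh).1
  · exact ⟨hj, informedCount_eq_zero_of_continuouslyJammed hj⟩
  · rw [advBudget, if_neg he]
    exact Nat.floor_le (by positivity)

end Jam

namespace Jam

/-! ### Rounds and phases -/

lemma two_rpow_eq (i : ℕ) :
    (2 : ℝ) ^ (3 * (i : ℝ) / 2) = (2 : ℝ) ^ i * Real.sqrt 2 ^ i := by
  rw [show 3 * (i : ℝ) / 2 = (3 / 2) * (i : ℝ) by ring, Real.rpow_mul (by norm_num),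
    rpow_three_halves 2 (by norm_num), Real.rpow_natCast, mul_pow]

lemma one_le_sqrt_two_pow (i : ℕ) : (1 : ℝ) ≤ Real.sqrt 2 ^ i :=
  one_le_pow₀ (Real.one_le_sqrt.2 (by norm_num))

lemma le_phaseLen (i : ℕ) : (2 : ℝ) ^ i * Real.sqrt 2 ^ i ≤ phaseLen i := by
  rw [phaseLen, two_rpow_eq]
  exact Nat.le_ceil _

lemma phaseLen_le (i : ℕ) : (phaseLen i : ℝ) ≤ 2 * ((2 : ℝ) ^ i * Real.sqrt 2 ^ i) := by
  rw [phaseLen, two_rpow_eq]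
  have h := Nat.ceil_lt_add_one (a := (2 : ℝ) ^ i * Real.sqrt 2 ^ i) (by positivity)
  have h1 : (1 : ℝ) ≤ (2 : ℝ) ^ i := one_le_pow₀ (by norm_num)
  nlinarith [one_le_sqrt_two_pow i]

lemma phaseLen_pos (i : ℕ) : 0 < phaseLen i := by
  unfold phaseLen
  exact Nat.ceil_pos.2 (by positivity)

lemma roundStart_one : roundStart 1 = 0 := by simp [roundStart]

lemma roundStart_succ {i : ℕ} (hi : 1 ≤ i) :
    roundStart (i + 1) = roundStart i + 3 * phaseLen i := by
  unfold roundStart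
  rw [Finset.sum_Ico_succ_top hi]

lemma roundStart_mono : Monotone roundStart := fun _ _ h =>
  Finset.sum_le_sum_of_subset (Finset.Ico_subset_Ico_right h)

lemma le_roundStart : ∀ i, i ≤ roundStart (i + 1)
  | 0 => Nat.zero_le _
  | i + 1 => by
      rw [roundStart_succ (by omega)]
      have := le_roundStart i
      have := phaseLen_pos (i + 1)
      omega

lemma roundOf_eq {i t : ℕ} (hi : 1 ≤ i) (h1 : roundStart i ≤ t) (h2 : t < roundStart (i + 1)) :
    roundOf t = i := by
  unfold roundOf
  rw [Nat.findGreatest_eq_iff]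
  refine ⟨?_, fun _ => h1, fun j hj _ hjt => ?_⟩
  · obtain ⟨j, rfl⟩ := Nat.exists_eq_add_of_le hi
    have := le_roundStart j
    rw [add_comm] at h1
    omega
  · have := roundStart_mono (show i + 1 ≤ j from hj)
    omega

lemma exists_round (t : ℕ) : ∃ i, 1 ≤ i ∧ roundStart i ≤ t ∧ t < roundStart (i + 1) := by
  have hex : ∃ j, t < roundStart (j + 1) := ⟨t + 1, lt_of_lt_of_le (Nat.lt_succ_self t)
    (le_roundStart (t + 1))⟩
  have h1 := Nat.find_spec hex
  have h0 : Nat.find hex ≠ 0 := by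
    intro h0
    rw [h0, zero_add, roundStart_one] at h1
    omega
  refine ⟨Nat.find hex, by omega, ?_, h1⟩
  have h2 := Nat.find_min hex (m := Nat.find hex - 1) (by omega)
  rw [Nat.sub_add_cancel (by omega)] at h2
  omega

lemma one_le_roundOf (t : ℕ) : 1 ≤ roundOf t := by
  obtain ⟨i, h0, h1, h2⟩ := exists_round t
  rwa [roundOf_eq h0 h1 h2]

lemma roundOf_lt_of_lt {i t : ℕ} (h : t < roundStart (i + 1)) : roundOf t ≤ i := by
  obtain ⟨j, h0, h1, h2⟩ := exists_round t
  rw [roundOf_eq h0 h1 h2]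
  by_contra hlt
  have := roundStart_mono (show i + 1 ≤ j by omega)
  omega

/-- The first slot of a phase of round `i`. -/
def phaseStart (i : ℕ) : Phase → ℕ
  | .inform => roundStart i
  | .propagation => roundStart i + phaseLen i
  | .request => roundStart i + 2 * phaseLen i

lemma roundOf_phaseOf_iff {i : ℕ} (hi : 1 ≤ i) (ph : Phase) (t : ℕ) :
    (roundOf t = i ∧ phaseOf t = ph) ↔
      phaseStart i ph ≤ t ∧ t < phaseStart i ph + phaseLen i := by
  have hL := phaseLen_pos i
  have key : ∀ r, r < 3 → roundStart i + r * phaseLen i ≤ t →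
      t < roundStart i + r * phaseLen i + phaseLen i →
      roundOf t = i ∧ (t - roundStart i) / phaseLen i = r := by
    intro r hr h1 h2
    have h3 : r * phaseLen i ≤ 2 * phaseLen i := Nat.mul_le_mul_right _ (by omega)
    refine ⟨roundOf_eq hi (by omega) (by rw [roundStart_succ hi]; omega), ?_⟩
    rw [Nat.div_eq_iff hL]
    constructor <;> omega
  constructor
  · rintro ⟨h1, h2⟩
    obtain ⟨j, h0, h3, h4⟩ := exists_round t
    have hj := roundOf_eq h0 h3 h4
    obtain rfl : j = i := hj ▸ h1
    rw [roundStart_succ h0] at h4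
    have hd := Nat.div_add_mod (t - roundStart j) (phaseLen j)
    have hm := Nat.mod_lt (t - roundStart j) hL
    unfold phaseOf at h2
    rw [h1] at h2
    set z := (t - roundStart j) / phaseLen j with hz
    have hz3 : z < 3 := by
      rw [hz, Nat.div_lt_iff_lt_mul hL]; omega
    clear_value z
    interval_cases z <;> subst h2 <;> simp only [phaseStart] <;> constructor <;> omega
  · intro h
    cases ph <;> simp only [phaseStart] at h
    · obtain ⟨h1, h2⟩ := key 0 (by norm_num) (by omega) (by omega)
      refine ⟨h1, ?_⟩
      simp only [phaseOf, h1, h2]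
    · obtain ⟨h1, h2⟩ := key 1 (by norm_num) (by omega) (by omega)
      refine ⟨h1, ?_⟩
      simp only [phaseOf, h1, h2]
    · obtain ⟨h1, h2⟩ := key 2 (by norm_num) (by omega) (by omega)
      refine ⟨h1, ?_⟩
      simp only [phaseOf, h1, h2]

lemma lastOfPhase_iff {i : ℕ} (hi : 1 ≤ i) {ph : Phase} {t : ℕ}
    (h : phaseStart i ph ≤ t ∧ t < phaseStart i ph + phaseLen i) :
    lastOfPhase t = true ↔ t + 1 = phaseStart i ph + phaseLen i := by
  have h1 := ((roundOf_phaseOf_iff hi ph t).2 h).1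
  have hL := phaseLen_pos i
  have key : ∀ r, phaseStart i ph = roundStart i + r * phaseLen i →
      (t - roundStart i) % phaseLen i = t - phaseStart i ph := by
    intro r hr
    have h2 : t - roundStart i = (t - phaseStart i ph) + phaseLen i * r := by
      rw [mul_comm]; omega
    rw [h2, Nat.add_mul_mod_self_left, Nat.mod_eq_of_lt (by omega)]
  have hmod : (t - roundStart i) % phaseLen i = t - phaseStart i ph := by
    cases ph
    · exact key 0 (by simp [phaseStart])
    · exact key 1 (by simp [phaseStart])
    · exact key 2 (by simp [phaseStart])
  rw [lastOfPhase, h1, decide_eq_true_iff, hmod]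
  omega

lemma phaseStart_add_le {i : ℕ} (hi : 1 ≤ i) (ph : Phase) :
    phaseStart i ph + phaseLen i ≤ roundStart (i + 1) := by
  rw [roundStart_succ hi]
  cases ph <;> simp only [phaseStart] <;> omega

/-! ### Counting slots of a history -/

variable {n b : ℕ} {Φ : Type}

lemma countSlots_le_of_imp {P Q : Slot n b Φ → List (Slot n b Φ) → Prop} :
    ∀ {h : List (Slot n b Φ)}, (∀ s h', s :: h' <:+ h → P s h' → Q s h') →
      countSlots P h ≤ countSlots Q h
  | [], _ => le_rfl
  | s :: h, H => by
      have ih := countSlots_le_of_imp (h := h) fun s' h' hs =>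
        H s' h' (hs.trans (List.suffix_cons s h))
      have h1 := H s h (List.suffix_refl _)
      simp only [countSlots]
      by_cases hP : P s h
      · simp [hP, h1 hP, ih]
      · simp only [hP, if_false]; omega

lemma countSlots_le_of_suffix {P : Slot n b Φ → List (Slot n b Φ) → Prop} :
    ∀ {h h' : List (Slot n b Φ)}, h' <:+ h → countSlots P h' ≤ countSlots P h
  | [], h', hs => by rw [List.suffix_nil.1 hs]
  | s :: h, h', hs => by
      rcases List.suffix_cons_iff.1 hs with rfl | h2
      · exact le_rfl
      · exact (countSlots_le_of_suffix h2).trans (Nat.le_add_right _ _)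

/-- Slots after the suffix `h'` do not count if `P` fails for them. -/
lemma countSlots_eq_of_suffix {P : Slot n b Φ → List (Slot n b Φ) → Prop}
    {h' : List (Slot n b Φ)} (hP : ∀ s h'', P s h'' → h''.length < h'.length) :
    ∀ {h : List (Slot n b Φ)}, h' <:+ h → countSlots P h = countSlots P h'
  | [], hs => by rw [List.suffix_nil.1 hs]
  | s :: h, hs => by
      rcases List.suffix_cons_iff.1 hs with rfl | h2
      · rfl
      · have : ¬ P s h := fun hp => absurd (hP s h hp) (not_lt.2 h2.length_le)
        simp only [countSlots, this, if_false, add_zero]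
        exact countSlots_eq_of_suffix hP h2

lemma countSlots_eq_zero {P : Slot n b Φ → List (Slot n b Φ) → Prop} {h : List (Slot n b Φ)}
    (H : ∀ s h', s :: h' <:+ h → ¬ P s h') : countSlots P h = 0 := by
  induction h with
  | nil => rfl
  | cons s h ih =>
      simp only [countSlots, H s h (List.suffix_refl _), if_false, add_zero]
      exact ih fun s' h' hs => H s' h' (hs.trans (List.suffix_cons s h))

/-- A window of `l` slots, all of which have one of the properties `P` and `Q`. -/
lemma le_countSlots_of_window {P Q : Slot n b Φ → List (Slot n b Φ) → Prop} {a l : ℕ} :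
    ∀ {h : List (Slot n b Φ)}, (∀ s h', s :: h' <:+ h → a ≤ h'.length → h'.length < a + l →
      P s h' ∨ Q s h') → min h.length (a + l) - a ≤ countSlots P h + countSlots Q h
  | [], _ => by simp
  | s :: h, H => by
      have ih := le_countSlots_of_window (h := h) fun s' h' hs =>
        H s' h' (hs.trans (List.suffix_cons s h))
      have h1 := H s h (List.suffix_refl _)
      simp only [countSlots, List.length_cons]
      by_cases hw : a ≤ h.length ∧ h.length < a + l
      · rcases h1 hw.1 hw.2 with hp | hp
        · simp only [hp, if_true]; omega
        · simp only [hp, if_true]; omega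
      · omega

lemma countSlots_attacked (h : List (Slot n b Φ)) :
    countSlots (fun s _ => Attacked s.adv) h = attackedSlots h := by
  induction h with
  | nil => rfl
  | cons s h ih =>
      simp only [countSlots, ih, attackedSlots, List.countP_cons]
      congr 1
      by_cases hs : Attacked s.adv
      · rw [if_pos hs, if_pos]
        simpa [Attacked] using hs
      · rw [if_neg hs, if_neg]
        simpa [Attacked] using hs

/-! ### The states of the devices -/

lemma length_view (h : List (Slot n b Φ)) (d : Fin (n + 1)) : (view h d).length = h.length := by
  induction h with
  | nil => rfl
  | cons s h ih => simp [view, ih]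

lemma holds_cons (s : Slot n b Φ) (h : List (Slot n b Φ)) (d : Fin (n + 1)) :
    (know (s :: h)).holds d = ((know h).holds d || isMsg (heard (know h) s d)) := rfl

lemma holds_of_suffix {d : Fin (n + 1)} {h' : List (Slot n b Φ)} :
    ∀ {h : List (Slot n b Φ)}, h' <:+ h → (know h').holds d = true → (know h).holds d = true
  | [], hs => by rw [List.suffix_nil.1 hs]; exact id
  | s :: h, hs => by
      rcases List.suffix_cons_iff.1 hs with rfl | h2
      · exact id
      · intro h1
        rw [holds_cons, holds_of_suffix h2 h1, Bool.true_or]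

lemma informedCount_le_of_suffix {h h' : List (Slot n b Φ)} (hs : h' <:+ h) :
    informedCount h' ≤ informedCount h := by
  refine Finset.card_le_card fun v hv => ?_
  simp only [Finset.mem_filter, Finset.mem_univ, true_and] at hv ⊢
  exact holds_of_suffix hs hv

lemma holds_zero (h : List (Slot n b Φ)) : (know h).holds 0 = true :=
  holds_of_suffix (List.nil_suffix) (by simp [know])

variable (c : ℝ)

/-- Alice's state after the history `h`. -/
abbrev aliceAt (h : List (Slot n b Unit)) : AliceState := aliceState n c (view h 0)

/-- The state of the node `v` after the history `h`. -/
abbrev nodeAt (h : List (Slot n b Unit)) (v : Fin n) : NodeState := nodeState n c (view h v.succ)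

lemma aliceAt_cons (s : Slot n b Unit) (h : List (Slot n b Unit)) :
    aliceAt c (s :: h) = aliceStep n c h.length (heard (know h) s 0) (aliceAt c h) := by
  simp [aliceAt, view, aliceState, length_view]

lemma nodeAt_cons (s : Slot n b Unit) (h : List (Slot n b Unit)) (v : Fin n) :
    nodeAt c (s :: h) v = nodeStep n c h.length (heard (know h) s v.succ) (nodeAt c h v) := by
  simp [nodeAt, view, nodeState, length_view]

/-- The state of a node is consistent with its possession of the message. A node that has given up
and one that has done its duty share the state `done`, about which nothing is said. -/
lemma holds_of_nodeAt (v : Fin n) : ∀ h : List (Slot n b Unit),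
    (∀ k, nodeAt c h v = .uninformed k → (know h).holds v.succ = false) ∧
      (nodeAt c h v = .informed → (know h).holds v.succ = true)
  | [] => by simp [nodeAt, view, nodeState, know]
  | s :: h => by
      obtain ⟨h1, h2⟩ := holds_of_nodeAt v h
      rw [nodeAt_cons, holds_cons]
      cases hn : nodeAt c h v with
      | done => simp [nodeStep]
      | informed =>
          simp only [nodeStep, h2 hn]
          cases phaseOf h.length
          · simp
          · dsimp only; split_ifs <;> simp
          · simp
      | uninformed k =>
          simp only [nodeStep, h1 k hn]
          by_cases hm : isMsg (heard (know h) s v.succ) = true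
          · cases phaseOf h.length <;> simp [hm]
          · rw [Bool.not_eq_true] at hm
            cases phaseOf h.length
            · simp [hm]
            · simp [hm]
            · simp only [hm]
              split_ifs <;> simp_all

/-- No device has given up: Alice is active, and so is every node without the message. -/
def Live (h : List (Slot n b Unit)) : Prop :=
  (∃ k, aliceAt c h = .active k) ∧
    ∀ v : Fin n, (know h).holds v.succ = false → ∃ k, nodeAt c h v = .uninformed k

/-- The slot after the history `h` belongs to the phase `ph` of round `i`, nobody has given up,
and fewer than `θ` nodes have the message. -/
def Trial (θ : ℝ) (i : ℕ) (ph : Phase) (h : List (Slot n b Unit)) : Prop :=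
  (roundOf h.length = i ∧ phaseOf h.length = ph) ∧ Live c h ∧ (informedCount h : ℝ) < θ

/-- Within the request phase of round `i`, Alice's counter is at least the number of noisy slots
that she has heard in this phase; its value at the beginning of the phase does not matter. -/
lemma countSlots_noisy_le_alice {i : ℕ} (hi : 1 ≤ i) :
    ∀ {h : List (Slot n b Unit)} {k : ℕ}, aliceAt c h = .active k →
      h.length < phaseStart i .request + phaseLen i →
      countSlots (fun s h => (roundOf h.length = i ∧ phaseOf h.length = .request) ∧
        isNoisy (heard (know h) s 0) = true) h ≤ k
  | [], k, _, _ => Nat.zero_le _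
  | s :: h, k, hk, hl => by
      rw [List.length_cons] at hl
      rw [aliceAt_cons] at hk
      simp only [countSlots]
      cases ha : aliceAt c h with
      | done => simp [ha, aliceStep] at hk
      | active k' =>
          have ih := countSlots_noisy_le_alice hi ha (by omega)
          by_cases hw : roundOf h.length = i ∧ phaseOf h.length = .request
          · have hw' := (roundOf_phaseOf_iff hi _ _).1 hw
            have hlast : lastOfPhase h.length = false := by
              rw [Bool.eq_false_iff, Ne, lastOfPhase_iff hi hw']; omega
            rw [ha] at hk
            simp only [aliceStep, hw.2, hlast, Bool.false_eq_true, if_false,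
              AliceState.active.injEq] at hk
            simp only [hw, true_and]
            split_ifs at hk ⊢ <;> omega
          · simp only [hw, false_and, if_false, add_zero]
            -- before the request phase of round `i` nothing has been counted
            have h0 : countSlots (fun s h => (roundOf h.length = i ∧
                phaseOf h.length = .request) ∧ isNoisy (heard (know h) s 0) = true) h = 0 := by
              refine countSlots_eq_zero fun s' h' hs ⟨hw', _⟩ => ?_
              have := hs.length_le
              rw [roundOf_phaseOf_iff hi] at hw hw'
              rw [List.length_cons] at this
              omega
            omega

lemma countSlots_noisy_le_node {i : ℕ} (hi : 1 ≤ i) (v : Fin n) :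
    ∀ {h : List (Slot n b Unit)} {k : ℕ}, nodeAt c h v = .uninformed k →
      h.length < phaseStart i .request + phaseLen i →
      countSlots (fun s h => (roundOf h.length = i ∧ phaseOf h.length = .request) ∧
        isNoisy (heard (know h) s v.succ) = true) h ≤ k
  | [], k, _, _ => Nat.zero_le _
  | s :: h, k, hk, hl => by
      rw [List.length_cons] at hl
      rw [nodeAt_cons] at hk
      simp only [countSlots]
      cases ha : nodeAt c h v with
      | done => simp [ha, nodeStep] at hk
      | informed =>
          exfalso
          rw [ha] at hk
          simp only [nodeStep] at hk
          cases hph : phaseOf h.length <;> simp only [hph, reduceCtorEq] at hk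
          split_ifs at hk
      | uninformed k' =>
          have ih := countSlots_noisy_le_node hi v ha (by omega)
          by_cases hw : roundOf h.length = i ∧ phaseOf h.length = .request
          · have hw' := (roundOf_phaseOf_iff hi _ _).1 hw
            have hlast : lastOfPhase h.length = false := by
              rw [Bool.eq_false_iff, Ne, lastOfPhase_iff hi hw']; omega
            rw [ha] at hk
            simp only [nodeStep, hw.2, hlast, Bool.false_eq_true, if_false] at hk
            simp only [hw, true_and]
            split_ifs at hk ⊢ <;> simp only [NodeState.uninformed.injEq] at hk <;> omega
          · simp only [hw, false_and, if_false, add_zero]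
            have h0 : countSlots (fun s h => (roundOf h.length = i ∧
                phaseOf h.length = .request) ∧ isNoisy (heard (know h) s v.succ) = true) h = 0 := by
              refine countSlots_eq_zero fun s' h' hs ⟨hw', _⟩ => ?_
              have := hs.length_le
              rw [roundOf_phaseOf_iff hi] at hw hw'
              rw [List.length_cons] at this
              omega
            omega

/-! ### What must go wrong for the protocol to fail -/

/-- Alice hears too few noisy slots in the request phase of round `i`, although the
uninformed nodes are numerous. -/
def AliceMisled (θ : ℝ) (i : ℕ) (h : List (Slot n b Unit)) : Prop :=
  (phaseLen i : ℝ) ≤ countSlots (fun _ h => Trial c θ i .request h) h ∧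
    (countSlots (fun s h => Trial c θ i .request h ∧ isNoisy (heard (know h) s 0) = true) h : ℝ) ≤
      5 * c * Real.log n

/-- The uninformed node `v` hears too few noisy slots in the request phase of round `i`, although
the uninformed nodes are numerous. -/
def NodeMisled (θ : ℝ) (i : ℕ) (v : Fin n) (h : List (Slot n b Unit)) : Prop :=
  (phaseLen i : ℝ) ≤ countSlots (fun _ h => Trial c θ i .request h ∧
      (know h).holds v.succ = false) h ∧
    (countSlots (fun s h => (Trial c θ i .request h ∧ (know h).holds v.succ = false) ∧
      isNoisy (heard (know h) s v.succ) = true) h : ℝ) ≤ 5 * c * Real.log n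

lemma suffix_of_suffix_cons {α : Type} {a : α} {l l' : List α} (h : a :: l <:+ l') : l <:+ l' :=
  (List.suffix_cons a l).trans h

/-- As long as the uninformed nodes are numerous and nobody is misled about this, nobody gives
up. -/
lemma live_of_not_misled {θ : ℝ} {I : ℕ} {h : List (Slot n b Unit)}
    (hθ : (informedCount h : ℝ) < θ)
    (hA : ∀ i, 1 ≤ i → i ≤ I → 3 * Real.logb 2 (Real.log n) ≤ i → ¬ AliceMisled c θ i h)
    (hV : ∀ i, 1 ≤ i → i ≤ I → 3 * Real.logb 2 (Real.log n) ≤ i → ∀ v, ¬ NodeMisled c θ i v h) :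
    ∀ h', h' <:+ h → h'.length ≤ roundStart (I + 1) → ∀ h'', h'' <:+ h' → Live c h''
  | [], _, _, h'', hs => by
      rw [List.suffix_nil.1 hs]
      exact ⟨⟨0, rfl⟩, fun v _ => ⟨0, rfl⟩⟩
  | s :: h', hs, hl, h'', hs' => by
      rw [List.length_cons] at hl
      have hsuf : h' <:+ h := suffix_of_suffix_cons hs
      have ih := live_of_not_misled hθ hA hV h' hsuf (by omega)
      rcases List.suffix_cons_iff.1 hs' with rfl | h2
      swap
      · exact ih h'' h2
      clear hs'
      have hmany : ∀ g, g <:+ h → (informedCount g : ℝ) < θ := fun g hg =>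
        lt_of_le_of_lt (by exact_mod_cast informedCount_le_of_suffix hg) hθ
      have hi := one_le_roundOf h'.length
      have hiI : roundOf h'.length ≤ I := roundOf_lt_of_lt (by omega)
      obtain ⟨⟨k, hk⟩, hlive⟩ := ih h' (List.suffix_refl _)
      -- a window that ends with the slot `s`
      have hwin : phaseOf h'.length = .request → lastOfPhase h'.length = true →
          (s :: h').length = phaseStart (roundOf h'.length) .request +
            phaseLen (roundOf h'.length) := by
        intro h1 h2
        have hw := (roundOf_phaseOf_iff hi _ _).1 ⟨rfl, h1⟩
        rw [lastOfPhase_iff hi hw] at h2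
        simpa using h2
      have htrial : ∀ s' g, s' :: g <:+ s :: h' →
          phaseStart (roundOf h'.length) .request ≤ g.length →
          g.length < phaseStart (roundOf h'.length) .request + phaseLen (roundOf h'.length) →
          Trial c θ (roundOf h'.length) .request g := by
        intro s' g hg h1 h2
        have hg' : g <:+ h' := by
          rcases List.suffix_cons_iff.1 hg with h3 | h3
          · rw [(List.cons.inj h3).2]
          · exact suffix_of_suffix_cons h3
        exact ⟨(roundOf_phaseOf_iff hi _ _).2 ⟨h1, h2⟩, ih g hg', hmany g (hg'.trans hsuf)⟩
      refine ⟨?_, fun v hv => ?_⟩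
      · rw [aliceAt_cons, hk]
        simp only [aliceStep]
        cases hph : phaseOf h'.length
        · exact ⟨k, rfl⟩
        · exact ⟨k, rfl⟩
        dsimp only
        set k' := if isNoisy (heard (know h') s 0) = true then k + 1 else k with hk'
        by_cases hlast : lastOfPhase h'.length = true
        swap
        · exact ⟨k', by simp [hlast]⟩
        by_cases hq : quits n c (roundOf h'.length) k' = true
        swap
        · exact ⟨0, by simp [hlast, hq]⟩
        exfalso
        have hlen := hwin hph hlast
        simp only [quits, decide_eq_true_eq] at hq
        refine hA _ hi hiI hq.1 ⟨?_, ?_⟩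
        · have h1 := le_countSlots_of_window (P := fun _ h => Trial c θ (roundOf h'.length)
            .request h) (Q := fun _ _ => False) (h := s :: h')
            (fun s' g hg h1 h2 => Or.inl (htrial s' g hg h1 h2))
          rw [countSlots_eq_zero (P := fun _ _ => False) (fun _ _ _ h => h), hlen] at h1
          have h2 := countSlots_le_of_suffix (P := fun _ h => Trial c θ (roundOf h'.length)
            .request h) hs
          exact_mod_cast (show _ ≤ _ by omega : phaseLen (roundOf h'.length) ≤ countSlots
            (fun _ h => Trial c θ (roundOf h'.length) .request h) h)
        · refine le_trans ?_ hq.2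
          rw [countSlots_eq_of_suffix _ hs]
          swap
          · rintro _ g ⟨⟨hg, -⟩, -⟩
            rw [hlen]
            exact ((roundOf_phaseOf_iff hi _ _).1 hg).2
          have h1 : countSlots (fun s h => Trial c θ (roundOf h'.length) .request h ∧
              isNoisy (heard (know h) s 0) = true) (s :: h') ≤ k' := by
            have h2 := countSlots_noisy_le_alice c hi hk (by rw [List.length_cons] at hlen; omega)
            refine le_trans (countSlots_le_of_imp (Q := fun s h => (roundOf h.length =
              roundOf h'.length ∧ phaseOf h.length = .request) ∧
              isNoisy (heard (know h) s 0) = true) fun s' g _ hg => ⟨hg.1.1, hg.2⟩) ?_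
            simp only [countSlots, hph, true_and, hk']
            split_ifs <;> omega
          exact_mod_cast h1
      · rw [holds_cons, Bool.or_eq_false_iff] at hv
        obtain ⟨k, hk⟩ := hlive v hv.1
        rw [nodeAt_cons, hk]
        simp only [nodeStep, hv.2]
        cases hph : phaseOf h'.length
        · exact ⟨k, rfl⟩
        · exact ⟨k, rfl⟩
        simp only [Bool.false_eq_true, if_false]
        set k' := if isNoisy (heard (know h') s v.succ) = true then k + 1 else k with hk'
        by_cases hlast : lastOfPhase h'.length = true
        swap
        · exact ⟨k', by simp [hlast]⟩
        by_cases hq : quits n c (roundOf h'.length) k' = true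
        swap
        · exact ⟨0, by simp [hlast, hq]⟩
        exfalso
        have hlen := hwin hph hlast
        have hno : ∀ g, g <:+ h' → (know g).holds v.succ = false := fun g hg => by
          rw [Bool.eq_false_iff]
          intro h1
          have := holds_of_suffix hg h1
          rw [hv.1] at this
          simp at this
        simp only [quits, decide_eq_true_eq] at hq
        refine hV _ hi hiI hq.1 v ⟨?_, ?_⟩
        · have h1 := le_countSlots_of_window (P := fun _ h => Trial c θ (roundOf h'.length)
            .request h ∧ (know h).holds v.succ = false) (Q := fun _ _ => False) (h := s :: h')
            (fun s' g hg h1 h2 => Or.inl ⟨htrial s' g hg h1 h2, hno g (by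
              rcases List.suffix_cons_iff.1 hg with h3 | h3
              · rw [(List.cons.inj h3).2]
              · exact suffix_of_suffix_cons h3)⟩)
          rw [countSlots_eq_zero (P := fun _ _ => False) (fun _ _ _ h => h), hlen] at h1
          have h2 := countSlots_le_of_suffix (P := fun _ h => Trial c θ (roundOf h'.length)
            .request h ∧ (know h).holds v.succ = false) hs
          exact_mod_cast (show _ ≤ _ by omega : phaseLen (roundOf h'.length) ≤ countSlots
            (fun _ h => Trial c θ (roundOf h'.length) .request h ∧
              (know h).holds v.succ = false) h)
        · refine le_trans ?_ hq.2
          rw [countSlots_eq_of_suffix _ hs]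
          swap
          · rintro _ g ⟨⟨⟨hg, -⟩, -⟩, -⟩
            rw [hlen]
            exact ((roundOf_phaseOf_iff hi _ _).1 hg).2
          have h1 : countSlots (fun s h => (Trial c θ (roundOf h'.length) .request h ∧
              (know h).holds v.succ = false) ∧
              isNoisy (heard (know h) s v.succ) = true) (s :: h') ≤ k' := by
            have h2 := countSlots_noisy_le_node c hi v hk (by rw [List.length_cons] at hlen; omega)
            refine le_trans (countSlots_le_of_imp (Q := fun s h => (roundOf h.length =
              roundOf h'.length ∧ phaseOf h.length = .request) ∧
              isNoisy (heard (know h) s v.succ) = true) fun s' g _ hg => ⟨hg.1.1.1, hg.2⟩) ?_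
            simp only [countSlots, hph, true_and, hk']
            split_ifs <;> omega
          exact_mod_cast h1

open Classical in
/-- The informed nodes that are due to send. -/
def relays (h : List (Slot n b Unit)) : Finset (Fin n) :=
  Finset.univ.filter fun v => nodeAt c h v = .informed

/-- Few nodes are informed in the inform phase of round `i`, although the uninformed nodes are
numerous and at most `B` slots are attacked. -/
def InformFails (θ : ℝ) (i : ℕ) (B s₀ : ℝ) (h : List (Slot n b Unit)) : Prop :=
  phaseLen i - B ≤ countSlots (fun s h => Trial c θ i .inform h ∧ ¬ Attacked s.adv) h ∧
    (countSlots (fun s h => (Trial c θ i .inform h ∧ ¬ Attacked s.adv) ∧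
      ∃ v : Fin n, (know h).holds v.succ = false ∧
        isMsg (heard (know h) s v.succ) = true) h : ℝ) ≤ s₀

/-- The node `v` does not get the message in the propagation phase of round `i`, although more
than `s₀` nodes relay it and at most `B` slots are attacked. -/
def PropagationFails (θ : ℝ) (i : ℕ) (B s₀ : ℝ) (v : Fin n) (h : List (Slot n b Unit)) : Prop :=
  phaseLen i - B ≤ countSlots (fun s h => (Trial c θ i .propagation h ∧
      (know h).holds v.succ = false ∧ s₀ < (relays c h).card) ∧ ¬ Attacked s.adv) h ∧
    (countSlots (fun s h => ((Trial c θ i .propagation h ∧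
      (know h).holds v.succ = false ∧ s₀ < (relays c h).card) ∧ ¬ Attacked s.adv) ∧
        isMsg (heard (know h) s v.succ) = true) h : ℝ) ≤ 0

/-- Each slot of the inform phase in which somebody is newly informed adds a relay, and no relay is
lost during this phase. -/
lemma hits_le_card_relays {θ : ℝ} {i : ℕ} (hi : 1 ≤ i) :
    ∀ {h : List (Slot n b Unit)}, h.length ≤ phaseStart i .inform + phaseLen i →
      countSlots (fun s h => (Trial c θ i .inform h ∧ ¬ Attacked s.adv) ∧
        ∃ v : Fin n, (know h).holds v.succ = false ∧
          isMsg (heard (know h) s v.succ) = true) h ≤ (relays c h).card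
  | [], _ => Nat.zero_le _
  | s :: h, hl => by
      rw [List.length_cons] at hl
      have ih := hits_le_card_relays (θ := θ) hi (h := h) (by omega)
      by_cases hw : roundOf h.length = i ∧ phaseOf h.length = .inform
      · have hsub : relays c h ⊆ relays c (s :: h) := by
          intro v hv
          simp only [relays, Finset.mem_filter, Finset.mem_univ, true_and] at hv ⊢
          rw [nodeAt_cons, hv]
          simp [nodeStep, hw.2]
        simp only [countSlots]
        split_ifs with hhit
        · obtain ⟨⟨hT, -⟩, v, hv, hm⟩ := hhit
          obtain ⟨k, hk⟩ := hT.2.1.2 v hv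
          have hv1 : v ∈ relays c (s :: h) := by
            simp only [relays, Finset.mem_filter, Finset.mem_univ, true_and]
            rw [nodeAt_cons, hk]
            simp [nodeStep, hw.2, hm]
          have hv2 : v ∉ relays c h := by
            simp [relays, hk]
          have := Finset.card_lt_card (Finset.ssubset_iff_of_subset hsub |>.2 ⟨v, hv1, hv2⟩)
          omega
        · exact ih.trans (Finset.card_le_card hsub)
      · -- the inform phase of round `i` has not begun
        rw [countSlots_eq_zero]
        · exact Nat.zero_le _
        · rintro s' h' hs ⟨⟨⟨hw', -⟩, -⟩, -⟩
          have := hs.length_le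
          rw [roundOf_phaseOf_iff hi] at hw hw'
          simp only [List.length_cons] at this
          rcases List.suffix_cons_iff.1 hs with h3 | h3
          · rw [(List.cons.inj h3).2] at hw'
            exact hw hw'
          · have := h3.length_le
            simp only [List.length_cons] at this
            omega

lemma relays_subset_of_suffix {i : ℕ} (hi : 1 ≤ i) {h' : List (Slot n b Unit)}
    (h0 : phaseStart i .propagation ≤ h'.length) :
    ∀ {h : List (Slot n b Unit)}, h' <:+ h →
      h.length < phaseStart i .propagation + phaseLen i → relays c h' ⊆ relays c h
  | [], hs, _ => by rw [List.suffix_nil.1 hs]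
  | s :: h, hs, hl => by
      rw [List.length_cons] at hl
      rcases List.suffix_cons_iff.1 hs with rfl | h2
      · exact Finset.Subset.refl _
      · refine (relays_subset_of_suffix hi h0 h2 (by omega)).trans fun v hv => ?_
        have hlen := h2.length_le
        have hw : phaseStart i .propagation ≤ h.length ∧
          h.length < phaseStart i .propagation + phaseLen i := ⟨by omega, by omega⟩
        have hw' := (roundOf_phaseOf_iff hi _ _).2 hw
        have hlast : lastOfPhase h.length = false := by
          rw [Bool.eq_false_iff, Ne, lastOfPhase_iff hi hw]; omega
        simp only [relays, Finset.mem_filter, Finset.mem_univ, true_and] at hv ⊢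
        rw [nodeAt_cons, hv]
        simp [nodeStep, hw'.2, hlast]

lemma exists_suffix_of_length_eq {α : Type} {l : List α} {m : ℕ} (h : m ≤ l.length) :
    ∃ l', l' <:+ l ∧ l'.length = m :=
  ⟨l.drop (l.length - m), List.drop_suffix _ _, by simp; omega⟩

/-- If nobody is misled and the two phases of the last round that spread the message succeed, then
only few nodes remain uninformed. -/
theorem le_informedCount_of_not_fails {θ B s₀ : ℝ} {I : ℕ} (hI : 1 ≤ I) (hθn : θ ≤ n)
    {h : List (Slot n b Unit)} (hlen : roundStart (I + 1) ≤ h.length)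
    (hB : (attackedSlots h : ℝ) ≤ B)
    (hA : ∀ i, 1 ≤ i → i ≤ I → 3 * Real.logb 2 (Real.log n) ≤ i → ¬ AliceMisled c θ i h)
    (hV : ∀ i, 1 ≤ i → i ≤ I → 3 * Real.logb 2 (Real.log n) ≤ i → ∀ v, ¬ NodeMisled c θ i v h)
    (hInf : ¬ InformFails c θ I B s₀ h) (hProp : ∀ v, ¬ PropagationFails c θ I B s₀ v h) :
    θ ≤ informedCount h := by
  by_contra hlt
  rw [not_le] at hlt
  have hlive : ∀ g, g <:+ h → g.length ≤ roundStart (I + 1) → Live c g := fun g hg hgl =>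
    live_of_not_misled c hlt hA hV g hg hgl g (List.suffix_refl _)
  have hmany : ∀ g, g <:+ h → (informedCount g : ℝ) < θ := fun g hg =>
    lt_of_le_of_lt (by exact_mod_cast informedCount_le_of_suffix hg) hlt
  have htrial : ∀ ph g, g <:+ h → phaseStart I ph ≤ g.length →
      g.length < phaseStart I ph + phaseLen I → Trial c θ I ph g := fun ph g hg h1 h2 =>
    ⟨(roundOf_phaseOf_iff hI _ _).2 ⟨h1, h2⟩,
      hlive g hg (by have := phaseStart_add_le hI ph; omega), hmany g hg⟩
  have hwindow : ∀ (ph : Phase) (P : List (Slot n b Unit) → Prop),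
      (∀ g, g <:+ h → phaseStart I ph ≤ g.length → g.length < phaseStart I ph + phaseLen I →
        P g) →
      (phaseLen I : ℝ) - B ≤ countSlots (fun s h => P h ∧ ¬ Attacked s.adv) h := by
    intro ph P hP
    have h1 := le_countSlots_of_window (P := fun s h => P h ∧ ¬ Attacked s.adv)
      (Q := fun s _ => Attacked s.adv) (a := phaseStart I ph) (l := phaseLen I) (h := h)
      (fun s g hg h1 h2 => by
        by_cases hs : Attacked s.adv
        · exact Or.inr hs
        · exact Or.inl ⟨hP g (suffix_of_suffix_cons hg) h1 h2, hs⟩)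
    rw [countSlots_attacked] at h1
    have h2 := phaseStart_add_le hI ph
    have h3 : phaseLen I ≤ countSlots (fun s h => P h ∧ ¬ Attacked s.adv) h +
      attackedSlots h := by omega
    have h4 : (phaseLen I : ℝ) ≤ countSlots (fun s h => P h ∧ ¬ Attacked s.adv) h +
      attackedSlots h := by exact_mod_cast h3
    linarith
  -- many relays at the end of the inform phase
  obtain ⟨h₁, hs₁, hl₁⟩ := exists_suffix_of_length_eq (l := h)
    (m := phaseStart I .inform + phaseLen I) ((phaseStart_add_le hI _).trans hlen)
  have hrel : s₀ < (relays c h₁).card := by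
    by_contra hle
    rw [not_lt] at hle
    refine hInf ⟨hwindow .inform _ fun g hg h1 h2 => htrial .inform g hg h1 h2, ?_⟩
    rw [countSlots_eq_of_suffix _ hs₁]
    · exact le_trans (by exact_mod_cast hits_le_card_relays c hI hl₁.le) hle
    · rintro _ g ⟨⟨⟨hg, -⟩, -⟩, -⟩
      rw [hl₁]
      exact ((roundOf_phaseOf_iff hI _ _).1 hg).2
  -- an uninformed node, which got the message in no slot
  obtain ⟨v, hv⟩ : ∃ v : Fin n, (know h).holds v.succ = false := by
    by_contra hne
    push Not at hne
    have : informedCount h = n := by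
      rw [informedCount, Finset.filter_true_of_mem]
      · simp
      · intro v _; simpa using hne v
    rw [this] at hlt
    linarith
  have hno : ∀ g, g <:+ h → (know g).holds v.succ = false := fun g hg => by
    rw [Bool.eq_false_iff]
    intro h1
    have := holds_of_suffix hg h1
    rw [hv] at this
    simp at this
  refine hProp v ⟨hwindow .propagation _ fun g hg h1 h2 => ⟨htrial .propagation g hg h1 h2,
    hno g hg, lt_of_lt_of_le hrel ?_⟩, ?_⟩
  · have hl : phaseStart I .propagation = phaseStart I .inform + phaseLen I := rfl
    exact_mod_cast Finset.card_le_card (relays_subset_of_suffix c hI (by omega)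
      (List.suffix_of_suffix_length_le hs₁ hg (by omega)) h2)
  · rw [countSlots_eq_zero]
    · simp
    · rintro s g hg ⟨-, hm⟩
      have := hno _ hg
      rw [holds_cons, hm, Bool.or_true] at this
      simp at this

end Jam

namespace Jam

/-! ### Coins and the actions of the protocol -/

lemma pr_map {α β : Type} (p : PMF α) (f : α → β) (E : β → Prop) :
    pr (p.map f) E = pr p fun a => E (f a) := by
  classical
  unfold pr
  rw [prob_eq_expect, prob_eq_expect, PMF.map, expect_bind]
  simp [expect_pure]

lemma expect_coin (p : ℝ) (F : Bool → ENNReal) :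
    expect (coin p) F = ENNReal.ofReal (max 0 (min 1 p)) * F true +
      ENNReal.ofReal (1 - max 0 (min 1 p)) * F false := by
  unfold expect
  rw [tsum_bool, add_comm]
  simp [coin]

lemma pr_coin (p : ℝ) : pr (coin p) (fun o => o = true) = max 0 (min 1 p) := by
  unfold pr
  rw [prob_eq_expect, expect_coin, if_pos rfl, if_neg (by simp), mul_one, mul_zero, add_zero,
    ENNReal.toReal_ofReal (le_max_left _ _)]

lemma pr_coin_of_mem {p : ℝ} (h0 : 0 ≤ p) (h1 : p ≤ 1) :
    pr (coin p) (fun o => o = true) = p := by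
  rw [pr_coin, min_eq_right h1, max_eq_right h0]

lemma pr_coin_le {p q : ℝ} (h0 : 0 ≤ q) (h : p ≤ q) : pr (coin p) (fun o => o = true) ≤ q := by
  rw [pr_coin]
  exact max_le h0 ((min_le_right _ _).trans h)

lemma pr_listenWithProb (p : ℝ) :
    pr (listenWithProb p) (fun x => x = .listen) = pr (coin p) fun o => o = true := by
  rw [listenWithProb, pr_map]
  congr 1; funext o; cases o <;> simp

lemma pr_sendWithProb (x : Frame Unit) (p : ℝ) :
    pr (sendWithProb x p) (fun y => y = .send x) = pr (coin p) fun o => o = true := by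
  rw [sendWithProb, pr_map]
  congr 1; funext o; cases o <;> simp

lemma pr_sendOrListen_send {p : ℝ} (q : ℝ) (h0 : 0 ≤ p) (h1 : p ≤ 1) :
    pr (sendOrListen nack p q) (fun y => y = .send nack) = p := by
  classical
  unfold pr
  rw [prob_eq_expect, sendOrListen, expect_bind, expect_coin, min_eq_right h1, max_eq_right h0]
  simp only [cond_true, cond_false, expect_pure]
  rw [← prob_eq_expect]
  have : prob (listenWithProb q) (fun y => y = .send nack) = 0 := by
    rw [prob_eq_expect, listenWithProb, PMF.map, expect_bind, expect_coin]
    simp [expect_pure]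
  rw [this]
  simp [h0]

lemma pr_sendOrListen_listen {p q : ℝ} (h0 : 0 ≤ p) (h1 : p ≤ 1) (h2 : 0 ≤ q) (h3 : q ≤ 1) :
    pr (sendOrListen nack p q) (fun y => y = .listen) = (1 - p) * q := by
  classical
  unfold pr
  rw [prob_eq_expect, sendOrListen, expect_bind, expect_coin, min_eq_right h1, max_eq_right h0]
  simp only [cond_true, cond_false, expect_pure]
  rw [← prob_eq_expect, ← ofReal_pr, pr_listenWithProb, pr_coin_of_mem h2 h3,
    ← ENNReal.ofReal_mul (by linarith)]
  simp [mul_nonneg (sub_nonneg.2 h1) h2]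

/-- An action other than a transmission: the device listens or sleeps. -/
def Quiet {Φ : Type} (x : Action Φ) : Prop := ∀ z, x ≠ .send z

lemma quiet_of_mem_support_listenWithProb {p : ℝ} {x : Action Unit}
    (h : x ∈ (listenWithProb p).support) : Quiet x := by
  simp only [listenWithProb, PMF.support_map, Set.mem_image] at h
  obtain ⟨o, -, rfl⟩ := h
  cases o <;> simp [Quiet]

lemma mem_support_sendWithProb {y : Frame Unit} {p : ℝ} {x : Action Unit}
    (h : x ∈ (sendWithProb y p).support) : x = .send y ∨ Quiet x := by
  simp only [sendWithProb, PMF.support_map, Set.mem_image] at h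
  obtain ⟨o, -, rfl⟩ := h
  cases o <;> simp [Quiet]

variable {n b : ℕ} {ε' c : ℝ}

lemma protocol_act_zero (h : List (Slot n b Unit)) :
    (protocol n ε' c).act 0 (view h 0) = aliceAct n ε' c h.length (aliceAt c h) := by
  simp [protocol, length_view]

lemma protocol_act_succ (h : List (Slot n b Unit)) (v : Fin n) :
    (protocol n ε' c).act v.succ (view h v.succ) =
      nodeAct n ε' c h.length (nodeAt c h v) := by
  simp [protocol, length_view, Fin.succ_ne_zero]

/-- No node transmits in an inform phase. -/
lemma quiet_nodeAct_inform {t : ℕ} (ht : phaseOf t = .inform) {st : NodeState}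
    {x : Action Unit} (h : x ∈ (nodeAct n ε' c t st).support) : Quiet x := by
  cases st with
  | done => simp only [nodeAct, PMF.mem_support_pure_iff] at h; subst h; simp [Quiet]
  | informed =>
      simp only [nodeAct, ht, PMF.mem_support_pure_iff] at h; subst h; simp [Quiet]
  | uninformed k =>
      simp only [nodeAct, ht] at h; exact quiet_of_mem_support_listenWithProb h

/-- Only the relays transmit in a propagation phase. -/
lemma quiet_nodeAct_propagation {t : ℕ} (ht : phaseOf t = .propagation) {st : NodeState}
    (hst : st ≠ .informed) {x : Action Unit} (h : x ∈ (nodeAct n ε' c t st).support) :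
    Quiet x := by
  cases st with
  | done => simp only [nodeAct, PMF.mem_support_pure_iff] at h; subst h; simp [Quiet]
  | informed => exact absurd rfl hst
  | uninformed k =>
      simp only [nodeAct, ht] at h; exact quiet_of_mem_support_listenWithProb h

lemma quiet_aliceAct_propagation {t : ℕ} (ht : phaseOf t = .propagation) {st : AliceState}
    {x : Action Unit} (h : x ∈ (aliceAct n ε' c t st).support) : Quiet x := by
  cases st <;> simp only [aliceAct, ht, PMF.mem_support_pure_iff] at h <;> subst h <;>
    simp [Quiet]

/-! ### What is heard in a slot -/

section Heard

variable {Φ : Type} {K : Knowledge n} {a : Fin (n + 1) → Action Φ}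
  {y : Fin (b + 1) → AdvAction n Φ} {d w : Fin (n + 1)}

lemma isNoisy_heard (hd : a d = .listen) {x : Frame Φ} (hw : a w = .send x) (hne : w ≠ d) :
    isNoisy (heard K ⟨a, y⟩ d) = true := by
  have hmem : authentic (K.holds w) x ∈ signalsAt K ⟨a, y⟩ d := by
    refine List.mem_append_left _ (List.mem_filterMap.2 ⟨w, ?_, ?_⟩)
    · simp [hne]
    · simp [emit, hw]
  simp only [heard, hd]
  match hl : signalsAt K ⟨a, y⟩ d, hmem with
  | [.noise], _ => rfl
  | [.frame z], _ => rfl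
  | u :: v :: l, _ => cases u <;> rfl

lemma filterMap_eq_singleton {α β : Type} {f : α → Option β} {w : α} {z : β} :
    ∀ {l : List α}, l.Nodup → w ∈ l → f w = some z → (∀ d ∈ l, d ≠ w → f d = none) →
      l.filterMap f = [z]
  | [], _, h, _, _ => by simp at h
  | u :: l, hn, h, hz, hno => by
      rw [List.nodup_cons] at hn
      by_cases hu : u = w
      · subst hu
        rw [List.filterMap_cons_some hz, List.filterMap_eq_nil_iff.2]
        intro d hd
        exact hno d (List.mem_cons_of_mem _ hd) fun h => hn.1 (h ▸ hd)
      · rw [List.filterMap_cons_none (hno u List.mem_cons_self hu)]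
        exact filterMap_eq_singleton hn.2 ((List.mem_cons.1 h).resolve_left fun h => hu h.symm) hz
          fun d hd => hno d (List.mem_cons_of_mem _ hd)

/-- In a slot without attacks in which `w` is the only sender, a listener receives the message. -/
lemma isMsg_heard (hd : a d = .listen) (hw : a w = .send .msg) (hK : K.holds w = true)
    (hq : ∀ u, u ≠ w → Quiet (a u)) (hy : ¬ Attacked y) :
    isMsg (heard K ⟨a, y⟩ d) = true := by
  have hne : w ≠ d := fun h => by rw [h, hd] at hw; cases hw
  have hs : signalsAt K ⟨a, y⟩ d = [.frame .msg] := by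
    unfold signalsAt
    rw [filterMap_eq_singleton (w := w) (z := .frame .msg), List.filterMap_eq_nil_iff.2]
    · rfl
    · intro e _
      simp only [Attacked, not_exists] at hy
      have := hy e
      revert this
      simp only [emitAdv]
      cases y e <;> simp [AdvAction.isAttack]
    · exact (List.nodup_finRange _).filter _
    · simp [hne]
    · simp [emit, hw, authentic, hK]
    · intro u _ hu
      have := hq u hu
      simp only [emit]
      cases hau : a u with
      | send z => exact absurd hau (this z)
      | sleep => rfl
      | listen => rfl
  simp [heard, hd, hs, resolve, isMsg]

end Heard

/-! ### The success probabilities of single slots -/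

lemma one_sub_pow_le_exp {y : ℝ} (hy : y ≤ 1) (m : ℕ) : (1 - y) ^ m ≤ Real.exp (-(y * m)) := by
  have h1 : 1 - y ≤ Real.exp (-y) := by have := Real.add_one_le_exp (-y); linarith
  calc (1 - y) ^ m ≤ Real.exp (-y) ^ m := pow_le_pow_left₀ (by linarith) h1 m
    _ = _ := by rw [← Real.exp_nat_mul]; congr 1; ring

lemma half_le_one_sub_exp_neg {x : ℝ} (h0 : 0 ≤ x) (h1 : x ≤ 1) :
    x / 2 ≤ 1 - Real.exp (-x) := by
  have h2 := Real.add_one_le_exp x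
  have h3 : Real.exp x * Real.exp (-x) = 1 := by rw [← Real.exp_add]; simp
  have h4 := Real.exp_pos (-x)
  -- `exp (-x) ≤ 1 / (1 + x) ≤ 1 - x / 2`
  nlinarith

lemma half_le_one_sub_pow {x y : ℝ} {m : ℕ} (h0 : 0 ≤ x) (h1 : x ≤ 1) (hy : y ≤ 1)
    (hx : x ≤ y * m) : x / 2 ≤ 1 - (1 - y) ^ m := by
  have h2 := one_sub_pow_le_exp hy m
  have h3 := half_le_one_sub_exp_neg h0 h1
  have h4 : Real.exp (-(y * m)) ≤ Real.exp (-x) := Real.exp_le_exp.2 (by linarith)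
  linarith

lemma exp_neg_one_le_pow {m s : ℕ} (hm : 2 ≤ m) (hs : s ≤ m) :
    Real.exp (-1) ≤ (1 - 1 / (m : ℝ)) ^ (s - 1) := by
  have hm' : (2 : ℝ) ≤ m := by exact_mod_cast hm
  have h0 : 0 ≤ 1 - 1 / (m : ℝ) := by
    rw [sub_nonneg, div_le_one (by linarith)]; linarith
  have h1 : 1 - 1 / (m : ℝ) ≤ 1 := by
    have : 0 ≤ 1 / (m : ℝ) := by positivity
    linarith
  have hm1 : (0 : ℝ) < m - 1 := by linarith
  -- `1 - 1 / m = 1 / (1 + 1 / (m - 1)) ≥ exp (-1 / (m - 1))`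
  have h2 : Real.exp (-(1 / ((m : ℝ) - 1))) ≤ 1 - 1 / (m : ℝ) := by
    have h3 := Real.add_one_le_exp (1 / ((m : ℝ) - 1))
    have h4 : 1 / ((m : ℝ) - 1) + 1 = m / (m - 1) := by field_simp; ring
    rw [Real.exp_neg, show 1 - 1 / (m : ℝ) = ((m : ℝ) / (m - 1))⁻¹ by field_simp]
    rw [h4] at h3
    exact inv_anti₀ (by positivity) h3
  calc Real.exp (-1) = Real.exp (-(1 / ((m : ℝ) - 1))) ^ (m - 1) := by
        rw [← Real.exp_nat_mul, Nat.cast_sub (by omega), Nat.cast_one]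
        congr 1; field_simp
    _ ≤ (1 - 1 / (m : ℝ)) ^ (m - 1) := pow_le_pow_left₀ (Real.exp_pos _).le h2 _
    _ ≤ _ := pow_le_pow_of_le_one h0 h1 (by omega)

/-- The nodes without the message, as devices. -/
def lacking (h : List (Slot n b Unit)) : Finset (Fin (n + 1)) :=
  (Finset.univ.filter fun v : Fin n => (know h).holds v.succ = false).map (Fin.succEmb n)

lemma mem_lacking {h : List (Slot n b Unit)} {d : Fin (n + 1)} :
    d ∈ lacking h ↔ ∃ v : Fin n, (know h).holds v.succ = false ∧ v.succ = d := by
  simp [lacking]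

lemma informedCount_add_card_lacking (h : List (Slot n b Unit)) :
    informedCount h + (lacking h).card = n := by
  have h1 := Finset.card_filter_add_card_filter_not (s := (Finset.univ : Finset (Fin n)))
    (fun v => (know h).holds v.succ = true)
  simp only [Finset.card_univ, Fintype.card_fin, Bool.not_eq_true] at h1
  rw [lacking, Finset.card_map]
  exact h1

lemma zero_notMem_lacking (h : List (Slot n b Unit)) : (0 : Fin (n + 1)) ∉ lacking h := by
  rw [mem_lacking]
  rintro ⟨v, -, hv⟩
  exact Fin.succ_ne_zero v hv

section Trials

variable {ε : ℝ} {i : ℕ} {h : List (Slot n b Unit)}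

lemma Trial.lt_card_lacking {ph : Phase} (hT : Trial c ((1 - ε) * n) i ph h) :
    ε * n < (lacking h).card := by
  have h1 : (informedCount h : ℝ) + (lacking h).card = n := by
    exact_mod_cast informedCount_add_card_lacking h
  have := hT.2.2
  linarith

lemma one_div_natCast_le_one (n : ℕ) : 1 / (n : ℝ) ≤ 1 := by
  rcases Nat.eq_zero_or_pos n with rfl | hn
  · simp
  · rw [div_le_one (by exact_mod_cast hn)]; exact_mod_cast hn

lemma Trial.pr_nack (hT : Trial c ((1 - ε) * n) i .request h) {u : Fin (n + 1)}
    (hu : u ∈ lacking h) :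
    pr ((protocol n ε' c).act u (view h u)) (fun x => x = .send nack) = 1 / n := by
  obtain ⟨v, hv, rfl⟩ := mem_lacking.1 hu
  obtain ⟨k, hk⟩ := hT.2.1.2 v hv
  rw [protocol_act_succ, hk]
  simp only [nodeAct, hT.1.2]
  exact pr_sendOrListen_send _ (by positivity) (one_div_natCast_le_one n)

/-- Alice listens and one of the many uninformed nodes sends a nack. -/
lemma le_pr_alice_noisy (hn : 1 ≤ n) (hε0 : 0 ≤ ε) (hε1 : ε ≤ 1)
    (hT : Trial c ((1 - ε) * n) i .request h) {p : ℝ}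
    (hp : p = c * Real.log n / ((1 - Real.exp (-4 * ε')) * (2 : ℝ) ^ (3 * (i : ℝ) / 2)))
    (hp0 : 0 ≤ p) (hp1 : p ≤ 1) (y : Fin (b + 1) → AdvAction n Unit) :
    p * (ε / 2) ≤ pr (indep (n + 1) fun d => (protocol n ε' c).act d (view h d))
      fun a => isNoisy (heard (know h) ⟨a, y⟩ 0) = true := by
  have hn' : (0 : ℝ) < n := by exact_mod_cast hn
  obtain ⟨k, hk⟩ := hT.2.1.1
  have hA : p ≤ pr ((protocol n ε' c).act 0 (view h 0)) (fun x => x = .listen) := by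
    rw [protocol_act_zero, hk]
    simp only [aliceAct, hT.1.1, hT.1.2]
    rw [pr_listenWithProb, ← hp, pr_coin_of_mem hp0 hp1]
  have h1 := le_pr_indep_and_exists (fun d => (protocol n ε' c).act d (view h d))
    (zero_notMem_lacking h) (fun x => x = .listen) (fun x => x = .send nack) hA
    (fun u hu => (hT.pr_nack hu).ge) (one_div_natCast_le_one n) (by positivity)
  refine le_trans (mul_le_mul_of_nonneg_left ?_ hp0) (h1.trans (pr_mono _ ?_))
  · refine half_le_one_sub_pow hε0 hε1 (one_div_natCast_le_one n) ?_
    rw [one_div, ← div_eq_inv_mul, le_div_iff₀ hn']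
    exact hT.lt_card_lacking.le
  · rintro a - ⟨ha, u, hu, hau⟩
    exact isNoisy_heard ha hau fun h0 => zero_notMem_lacking h (h0 ▸ hu)

/-- An uninformed node listens and another one sends a nack; the factor `1 / 2` accounts for the
slots in which the node itself sends. -/
lemma le_pr_node_noisy (hn : 2 ≤ n) (hε0 : 0 ≤ ε) (hε1 : ε ≤ 1) (hεn : 2 ≤ ε * n)
    (hT : Trial c ((1 - ε) * n) i .request h) {v : Fin n} (hv : (know h).holds v.succ = false)
    {q : ℝ} (hq : q = (c + 1) / ((1 - Real.exp (-64 * ε')) * 2 ^ i))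
    (hq0 : 0 ≤ q) (hq1 : q ≤ 1) (y : Fin (b + 1) → AdvAction n Unit) :
    q * (ε / 8) ≤ pr (indep (n + 1) fun d => (protocol n ε' c).act d (view h d))
      fun a => isNoisy (heard (know h) ⟨a, y⟩ v.succ) = true := by
  have hn' : (2 : ℝ) ≤ n := by exact_mod_cast hn
  obtain ⟨k, hk⟩ := hT.2.1.2 v hv
  have hA : 1 / 2 * q ≤
      pr ((protocol n ε' c).act v.succ (view h v.succ)) (fun x => x = .listen) := by
    rw [protocol_act_succ, hk]
    simp only [nodeAct, hT.1.1, hT.1.2]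
    rw [← hq, pr_sendOrListen_listen (by positivity) (one_div_natCast_le_one n) hq0 hq1]
    refine mul_le_mul_of_nonneg_right ?_ hq0
    have : 1 / (n : ℝ) ≤ 1 / 2 := one_div_le_one_div_of_le (by norm_num) hn'
    linarith
  have hvm : v.succ ∈ lacking h := mem_lacking.2 ⟨v, hv, rfl⟩
  have h1 := le_pr_indep_and_exists (fun d => (protocol n ε' c).act d (view h d))
    (Finset.notMem_erase v.succ (lacking h)) (fun x => x = .listen) (fun x => x = .send nack) hA
    (fun u hu => (hT.pr_nack (Finset.mem_of_mem_erase hu)).ge) (one_div_natCast_le_one n)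
    (by positivity)
  refine le_trans (le_of_eq (by ring)) (le_trans (mul_le_mul_of_nonneg_left
    (?_ : ε / 2 / 2 ≤ _) (by positivity : 0 ≤ 1 / 2 * q)) (h1.trans (pr_mono _ ?_)))
  · refine half_le_one_sub_pow (by linarith) (by linarith) (one_div_natCast_le_one n) ?_
    rw [one_div, ← div_eq_inv_mul, le_div_iff₀ (by linarith), Finset.card_erase_of_mem hvm,
      Nat.cast_sub (Finset.card_pos.2 ⟨_, hvm⟩), Nat.cast_one]
    have := hT.lt_card_lacking
    linarith
  · rintro a - ⟨ha, u, hu, hau⟩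
    exact isNoisy_heard ha hau (Finset.ne_of_mem_erase hu)

/-- Alice sends and some uninformed node listens: nobody else transmits in an inform phase. -/
lemma le_pr_informed {x p q : ℝ} (hx0 : 0 ≤ x) (hx1 : x ≤ 1)
    (hT : Trial c ((1 - ε) * n) i .inform h)
    (hp : p = 2 * Real.log n / 2 ^ i) (hp0 : 0 ≤ p) (hp1 : p ≤ 1)
    (hq : q = 2 / (ε' * 2 ^ i)) (hq0 : 0 ≤ q) (hq1 : q ≤ 1) (hx : x ≤ q * (ε * n))
    {y : Fin (b + 1) → AdvAction n Unit} (hy : ¬ Attacked y) :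
    p * (x / 2) ≤ pr (indep (n + 1) fun d => (protocol n ε' c).act d (view h d))
      fun a => ∃ v : Fin n, (know h).holds v.succ = false ∧
        isMsg (heard (know h) ⟨a, y⟩ v.succ) = true := by
  obtain ⟨k, hk⟩ := hT.2.1.1
  have hA : p ≤ pr ((protocol n ε' c).act 0 (view h 0)) (fun x => x = .send .msg) := by
    rw [protocol_act_zero, hk]
    simp only [aliceAct, hT.1.1, hT.1.2]
    rw [pr_sendWithProb, ← hp, pr_coin_of_mem hp0 hp1]
  have hL : ∀ u ∈ lacking h,
      q ≤ pr ((protocol n ε' c).act u (view h u)) (fun x => x = .listen) := by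
    intro u hu
    obtain ⟨v, hv, rfl⟩ := mem_lacking.1 hu
    obtain ⟨k, hk⟩ := hT.2.1.2 v hv
    rw [protocol_act_succ, hk]
    simp only [nodeAct, hT.1.1, hT.1.2]
    rw [pr_listenWithProb, ← hq, pr_coin_of_mem hq0 hq1]
  have h1 := le_pr_indep_and_exists (fun d => (protocol n ε' c).act d (view h d))
    (zero_notMem_lacking h) (fun x => x = .send .msg) (fun x => x = .listen) hA hL hq1 hq0
  refine le_trans (mul_le_mul_of_nonneg_left ?_ hp0) (h1.trans (pr_mono _ ?_))
  · refine half_le_one_sub_pow hx0 hx1 hq1 (hx.trans ?_)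
    exact mul_le_mul_of_nonneg_left hT.lt_card_lacking.le hq0
  · rintro a hsup ⟨ha, u, hu, hau⟩
    obtain ⟨v, hv, rfl⟩ := mem_lacking.1 hu
    refine ⟨v, hv, isMsg_heard hau ha (holds_zero h) (fun w hw => ?_) hy⟩
    obtain ⟨w, rfl⟩ := Fin.exists_succ_eq.2 hw
    have := mem_support_indep hsup w.succ
    rw [protocol_act_succ] at this
    exact quiet_nodeAct_inform hT.1.2 this

/-- The node `v` listens and exactly one of more than `s₀` relays sends; the other relays are silent
with probability at least `(1 - 1 / n) ^ (n - 1) ≥ exp (-1)`. -/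
lemma le_pr_relayed (hn : 2 ≤ n) {s₀ q : ℝ}
    (hT : Trial c ((1 - ε) * n) i .propagation h) {v : Fin n}
    (hv : (know h).holds v.succ = false) (hs : s₀ < (relays c h).card)
    (hq : q = 4 * Real.exp 1 * (c + 1) / 2 ^ i) (hq0 : 0 ≤ q) (hq1 : q ≤ 1)
    {y : Fin (b + 1) → AdvAction n Unit} (hy : ¬ Attacked y) :
    q * (s₀ / n * Real.exp (-1)) ≤
      pr (indep (n + 1) fun d => (protocol n ε' c).act d (view h d))
        fun a => isMsg (heard (know h) ⟨a, y⟩ v.succ) = true := by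
  have hn' : (2 : ℝ) ≤ n := by exact_mod_cast hn
  obtain ⟨k, hk⟩ := hT.2.1.2 v hv
  have hA : pr ((protocol n ε' c).act v.succ (view h v.succ)) (fun x => x = .listen) = q := by
    rw [protocol_act_succ, hk]
    simp only [nodeAct, hT.1.1, hT.1.2]
    rw [pr_listenWithProb, ← hq, pr_coin_of_mem hq0 hq1]
  set I := (relays c h).map (Fin.succEmb n) with hI
  have hmem : ∀ u, u ∈ I ↔ ∃ w : Fin n, nodeAt c h w = .informed ∧ w.succ = u := by
    intro u; simp [hI, relays]
  have hF : ∀ u ∈ I, pr ((protocol n ε' c).act u (view h u)) (fun x => x = .send .msg) =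
      1 / n := by
    intro u hu
    obtain ⟨w, hw, rfl⟩ := (hmem u).1 hu
    rw [protocol_act_succ, hw]
    simp only [nodeAct, hT.1.2]
    rw [pr_sendWithProb, pr_coin_of_mem (by positivity) (one_div_natCast_le_one n)]
  have hvI : v.succ ∉ I := by
    rw [hmem]
    rintro ⟨w, hw, hwv⟩
    rw [Fin.succ_inj.1 hwv, hk] at hw
    cases hw
  have h1 := le_pr_indep_and_existsUnique (fun d => (protocol n ε' c).act d (view h d)) hvI
    (fun x => x = .listen) (fun x => x = .send .msg) hF
  rw [hA] at h1
  refine le_trans (mul_le_mul_of_nonneg_left ?_ hq0) (h1.trans (pr_mono _ ?_))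
  · have hc : I.card = (relays c h).card := Finset.card_map _
    have hcn : I.card ≤ n := by
      rw [hc]; simpa using Finset.card_le_univ (relays c h)
    have h2 := exp_neg_one_le_pow hn hcn
    calc s₀ / n * Real.exp (-1) ≤ (I.card : ℝ) / n * Real.exp (-1) := by
          refine mul_le_mul_of_nonneg_right ?_ (Real.exp_pos _).le
          rw [hc]; gcongr
      _ ≤ (I.card : ℝ) / n * (1 - 1 / (n : ℝ)) ^ (I.card - 1) :=
          mul_le_mul_of_nonneg_left h2 (by positivity)
      _ = _ := by ring
  · rintro a hsup ⟨ha, w, hw, haw, huniq⟩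
    obtain ⟨w', hw', rfl⟩ := (hmem w).1 hw
    refine isMsg_heard ha haw ((holds_of_nodeAt c w' h).2 hw') (fun u hu => ?_) hy
    have hsu := mem_support_indep hsup u
    rcases Fin.eq_zero_or_eq_succ u with rfl | ⟨u, rfl⟩
    · rw [protocol_act_zero] at hsu
      exact quiet_aliceAct_propagation hT.1.2 hsu
    · rw [protocol_act_succ] at hsu
      by_cases hin : nodeAt c h u = .informed
      · have h3 := huniq u.succ ((hmem _).2 ⟨u, hin, rfl⟩) hu
        rw [hin] at hsu
        simp only [nodeAct, hT.1.2] at hsu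
        exact (mem_support_sendWithProb hsu).resolve_left h3
      · exact quiet_nodeAct_propagation hT.1.2 hin hsu

end Trials

end Jam

namespace Jam

/-! ### The energy spent by the protocol -/

lemma sqrt_two_pow (i : ℕ) : Real.sqrt 2 ^ i = Real.sqrt (2 ^ i) := by
  rw [Real.sqrt_eq_rpow, Real.sqrt_eq_rpow, ← Real.rpow_natCast, ← Real.rpow_natCast,
    ← Real.rpow_mul (by norm_num), ← Real.rpow_mul (by norm_num), mul_comm]

lemma one_four_le_sqrt_two : (1.4 : ℝ) ≤ Real.sqrt 2 := by
  rw [Real.le_sqrt (by norm_num) (by norm_num)]; norm_num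

lemma roundStart_succ_le : ∀ i, (roundStart (i + 1) : ℝ) ≤ 12 * (2 ^ i * Real.sqrt 2 ^ i)
  | 0 => by rw [zero_add, roundStart_one]; simp
  | i + 1 => by
      rw [roundStart_succ (by omega)]
      have h1 := roundStart_succ_le i
      have h2 := phaseLen_le (i + 1)
      have h3 := one_four_le_sqrt_two
      have h4 : (0 : ℝ) < 2 ^ i * Real.sqrt 2 ^ i := by positivity
      have h5 : (2 : ℝ) ^ (i + 1) * Real.sqrt 2 ^ (i + 1) =
        2 * Real.sqrt 2 * (2 ^ i * Real.sqrt 2 ^ i) := by ring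
      rw [h5] at h2 ⊢
      push_cast
      nlinarith

lemma sum_inv_two_pow_roundOf_le : ∀ M, ∑ t ∈ Finset.range (roundStart (M + 1)),
    1 / (2 : ℝ) ^ roundOf t ≤ 24 * Real.sqrt 2 ^ M
  | 0 => by rw [zero_add, roundStart_one]; simp
  | M + 1 => by
      have h1 := sum_inv_two_pow_roundOf_le M
      have hr := roundStart_succ (i := M + 1) (by omega)
      rw [Finset.range_eq_Ico] at h1 ⊢
      rw [← Finset.sum_Ico_consecutive _ (Nat.zero_le _) (roundStart_mono (Nat.le_succ (M + 1)))]
      have h2 : ∑ t ∈ Finset.Ico (roundStart (M + 1)) (roundStart (M + 1 + 1)),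
          1 / (2 : ℝ) ^ roundOf t = 3 * phaseLen (M + 1) / 2 ^ (M + 1) := by
        rw [Finset.sum_congr rfl (g := fun _ => 1 / (2 : ℝ) ^ (M + 1))]
        · rw [Finset.sum_const, Nat.card_Ico, hr]
          simp; ring
        · intro t ht
          rw [Finset.mem_Ico] at ht
          rw [roundOf_eq (by omega) ht.1 ht.2]
      have h3 : 3 * (phaseLen (M + 1) : ℝ) / 2 ^ (M + 1) ≤ 6 * Real.sqrt 2 ^ (M + 1) := by
        rw [div_le_iff₀ (by positivity)]
        have := phaseLen_le (M + 1)
        linarith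
      rw [h2]
      have h4 := one_four_le_sqrt_two
      have h5 : (0 : ℝ) < Real.sqrt 2 ^ M := by positivity
      rw [pow_succ (Real.sqrt 2)] at h3 ⊢
      nlinarith

variable {n b : ℕ} {ε' c : ℝ}

lemma one_sub_exp_neg_pos {x : ℝ} (hx : 0 < x) : 0 < 1 - Real.exp (-x) := by
  rw [sub_pos, Real.exp_lt_one_iff]; linarith

lemma pr_listenWithProb_active_le {p q : ℝ} (h0 : 0 ≤ q) (h : p ≤ q) :
    pr (listenWithProb p) (fun x => x.isActive = true) ≤ q := by
  rw [listenWithProb, pr_map]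
  refine le_trans (pr_mono _ fun o _ ho => ?_) (pr_coin_le h0 h)
  cases o <;> simp_all [Action.isActive]

lemma pr_sendWithProb_active_le {z : Frame Unit} {p q : ℝ} (h0 : 0 ≤ q) (h : p ≤ q) :
    pr (sendWithProb z p) (fun x => x.isActive = true) ≤ q := by
  rw [sendWithProb, pr_map]
  refine le_trans (pr_mono _ fun o _ ho => ?_) (pr_coin_le h0 h)
  cases o <;> simp_all [Action.isActive]

lemma pr_sleep_active : pr (PMF.pure (Action.sleep : Action Unit)) (fun x => x.isActive = true) =
    0 := by
  rw [pr_pure]; simp [Action.isActive]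

lemma pr_sendOrListen_active_le {p q r : ℝ} (hp0 : 0 ≤ p) (hp1 : p ≤ 1) (h0 : 0 ≤ r)
    (h : q ≤ r) : pr (sendOrListen nack p q) (fun x => x.isActive = true) ≤ p + r := by
  have h1 := pr_listenWithProb_active_le h0 h
  have h2 : prob (sendOrListen nack p q) (fun x => x.isActive = true) ≤
      ENNReal.ofReal (p + r) := by
    classical
    rw [prob_eq_expect, sendOrListen, expect_bind, expect_coin, min_eq_right hp1,
      max_eq_right hp0]
    simp only [cond_true, cond_false]
    rw [← prob_eq_expect, ← prob_eq_expect, ← ofReal_pr (listenWithProb q),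
      ← ENNReal.ofReal_mul (by linarith), ENNReal.ofReal_add hp0 h0]
    refine add_le_add (mul_le_of_le_one_right zero_le (prob_le_one _ _))
      (ENNReal.ofReal_le_ofReal ?_)
    nlinarith [pr_nonneg (listenWithProb q) (fun x => x.isActive = true)]
  exact ENNReal.toReal_le_of_le_ofReal (by linarith) h2

lemma pr_alice_active_le (hc : 0 ≤ c) (hε' : 0 < ε') (h : List (Slot n b Unit)) :
    pr ((protocol n ε' c).act 0 (view h 0)) (fun x => x.isActive = true) ≤
      (2 + c / (1 - Real.exp (-4 * ε'))) * Real.log n * (1 / 2 ^ roundOf h.length) := by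
  have hw : 0 < 1 - Real.exp (-4 * ε') := by
    have := one_sub_exp_neg_pos (x := 4 * ε') (by linarith)
    rwa [← neg_mul] at this
  have hl : 0 ≤ Real.log n := Real.log_natCast_nonneg n
  have hnn : 0 ≤ (2 + c / (1 - Real.exp (-4 * ε'))) * Real.log n *
    (1 / 2 ^ roundOf h.length) := by positivity
  rw [protocol_act_zero]
  cases aliceAt c h with
  | done => simp only [aliceAct]; rw [pr_sleep_active]; exact hnn
  | active k =>
      simp only [aliceAct]
      cases phaseOf h.length
      · refine pr_sendWithProb_active_le hnn ?_
        rw [div_eq_mul_one_div]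
        gcongr
        have : 0 ≤ c / (1 - Real.exp (-4 * ε')) := by positivity
        linarith
      · rw [pr_sleep_active]; exact hnn
      · refine pr_listenWithProb_active_le hnn ?_
        calc c * Real.log n / ((1 - Real.exp (-4 * ε')) * 2 ^ (3 * (roundOf h.length : ℝ) / 2))
            ≤ c * Real.log n / ((1 - Real.exp (-4 * ε')) * 2 ^ roundOf h.length) := by
              rw [two_rpow_eq]
              gcongr
              exact le_mul_of_one_le_right (by positivity) (one_le_sqrt_two_pow _)
          _ = c / (1 - Real.exp (-4 * ε')) * Real.log n * (1 / 2 ^ roundOf h.length) := by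
              field_simp
          _ ≤ _ := by gcongr; linarith

lemma pr_node_active_le (hc : 0 ≤ c) (hε' : 0 < ε') (h : List (Slot n b Unit)) (v : Fin n) :
    pr ((protocol n ε' c).act v.succ (view h v.succ)) (fun x => x.isActive = true) ≤
      (2 / ε' + 4 * Real.exp 1 * (c + 1) + (c + 1) / (1 - Real.exp (-64 * ε'))) *
        (1 / 2 ^ roundOf h.length) + 1 / n := by
  have hw : 0 < 1 - Real.exp (-64 * ε') := by
    have := one_sub_exp_neg_pos (x := 64 * ε') (by linarith)
    rwa [← neg_mul] at this
  have h1 : 0 ≤ 2 / ε' := by positivity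
  have h2 : 0 ≤ 4 * Real.exp 1 * (c + 1) := by positivity
  have h3 : 0 ≤ (c + 1) / (1 - Real.exp (-64 * ε')) := by positivity
  have h4 : (0 : ℝ) ≤ 1 / n := by positivity
  have h5 : (0 : ℝ) < 1 / 2 ^ roundOf h.length := by positivity
  set D := 2 / ε' + 4 * Real.exp 1 * (c + 1) + (c + 1) / (1 - Real.exp (-64 * ε')) with hD
  have hD0 : 0 ≤ D := by positivity
  have hnn : 0 ≤ D * (1 / 2 ^ roundOf h.length) + 1 / n := by positivity
  rw [protocol_act_succ]
  cases nodeAt c h v with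
  | done => simp only [nodeAct]; rw [pr_sleep_active]; exact hnn
  | informed =>
      simp only [nodeAct]
      cases phaseOf h.length
      · rw [pr_sleep_active]; exact hnn
      · refine pr_sendWithProb_active_le hnn ?_
        have : 0 ≤ D * (1 / 2 ^ roundOf h.length) := by positivity
        linarith
      · rw [pr_sleep_active]; exact hnn
  | uninformed k =>
      simp only [nodeAct]
      cases phaseOf h.length
      · refine pr_listenWithProb_active_le hnn ?_
        rw [← div_div, div_eq_mul_one_div]
        nlinarith
      · refine pr_listenWithProb_active_le hnn ?_
        rw [div_eq_mul_one_div]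
        nlinarith
      · rw [add_comm (D * _)]
        refine pr_sendOrListen_active_le h4 (one_div_natCast_le_one n) (by positivity) ?_
        rw [← div_div, div_eq_mul_one_div]
        nlinarith

lemma sum_cost_rate_le {M T : ℕ} (hT : T ≤ roundStart (M + 1)) {D : ℝ} (hD : 0 ≤ D) :
    ∑ t ∈ Finset.range T, D * (1 / (2 : ℝ) ^ roundOf t) ≤ D * (24 * Real.sqrt 2 ^ M) := by
  rw [← Finset.mul_sum]
  refine mul_le_mul_of_nonneg_left (le_trans ?_ (sum_inv_two_pow_roundOf_le M)) hD
  exact Finset.sum_le_sum_of_subset_of_nonneg (Finset.range_subset_range.2 hT)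
    fun _ _ _ => by positivity

/-! ### The probabilities of the failures -/

section Failures

variable {ε : ℝ} {i : ℕ} (budget : Fin (b + 1) → ℝ) (S : Strategy n b Unit) (t : ℕ)

lemma log_pow_three_le (hΛ : 0 < Real.log n) (hi : 3 * Real.logb 2 (Real.log n) ≤ i) :
    Real.log n ^ 3 ≤ 2 ^ i := by
  calc Real.log n ^ 3 = (2 : ℝ) ^ (3 * Real.logb 2 (Real.log n)) := by
        rw [mul_comm, Real.rpow_mul (by norm_num),
          Real.rpow_logb (by norm_num) (by norm_num) hΛ]
        exact_mod_cast (Real.rpow_natCast (Real.log n) 3).symm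
    _ ≤ (2 : ℝ) ^ (i : ℝ) := Real.rpow_le_rpow_of_exponent_le (by norm_num) hi
    _ = _ := Real.rpow_natCast 2 i

/-- The expected number of noisy slots that Alice hears is at least `20 c ln n`, four times the
threshold of her test. -/
lemma prob_aliceMisled_le (hn : 1 ≤ n) (hε0 : 0 ≤ ε) (hε1 : ε ≤ 1) (hε' : 0 < ε')
    (hεε' : ε' ≤ ε / 160) (hc : 0 ≤ c) (hΛ : 1 ≤ Real.log n)
    (hcΛ : c / (1 - Real.exp (-4 * ε')) ≤ Real.log n ^ 2)
    (hi : 3 * Real.logb 2 (Real.log n) ≤ i) :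
    prob (run budget (protocol n ε' c) S t) (AliceMisled c ((1 - ε) * n) i) ≤
      ENNReal.ofReal (Real.exp (-(c * Real.log n))) := by
  have hw : 0 < 1 - Real.exp (-4 * ε') := by
    have := one_sub_exp_neg_pos (x := 4 * ε') (by linarith)
    rwa [← neg_mul] at this
  have hΛ3 := log_pow_three_le (by linarith) hi
  set Λ := Real.log n with hΛdef
  set w := 1 - Real.exp (-4 * ε') with hwdef
  have hw4 : w ≤ 4 * ε' := by
    have := Real.add_one_le_exp (-4 * ε'); linarith
  have hs := one_le_sqrt_two_pow i
  have hL := le_phaseLen i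
  have h2i : (0 : ℝ) < 2 ^ i * Real.sqrt 2 ^ i := by positivity
  set p := c * Λ / (w * (2 : ℝ) ^ (3 * (i : ℝ) / 2)) with hp
  rw [two_rpow_eq] at hp
  have hp0 : 0 ≤ p := by rw [hp]; positivity
  have hp1 : p ≤ 1 := by
    rw [hp, ← div_div, div_le_one h2i]
    calc c * Λ / w = c / w * Λ := by ring
      _ ≤ Λ ^ 2 * Λ := by gcongr
      _ = Λ ^ 3 := by ring
      _ ≤ 2 ^ i := hΛ3
      _ ≤ _ := le_mul_of_one_le_right (by positivity) hs
  refine le_trans (prob_few_hits_le budget (protocol n ε' c) S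
    (fun _ h => Trial c ((1 - ε) * n) i .request h)
    (fun s h => isNoisy (heard (know h) s 0) = true) (by positivity : 0 ≤ p * (ε / 2))
    (fun h y hT => le_pr_alice_noisy hn hε0 hε1 hT rfl hp0 hp1 y) _ _ t) ?_
  refine ENNReal.ofReal_le_ofReal (Real.exp_le_exp.2 ?_)
  have h1 : c * Λ / (4 * ε') ≤ p * phaseLen i := by
    calc c * Λ / (4 * ε') ≤ c * Λ / w := by gcongr
      _ = p * (2 ^ i * Real.sqrt 2 ^ i) := by rw [hp]; field_simp
      _ ≤ _ := by gcongr
  have h2 : 40 * (c * Λ) ≤ p * phaseLen i * ε := by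
    calc 40 * (c * Λ) = c * Λ / (4 * ε') * (160 * ε') := by field_simp; ring
      _ ≤ (p * phaseLen i) * ε := by
          refine mul_le_mul h1 (by linarith) (by positivity) (by positivity)
  nlinarith

/-- The expected number of noisy slots that a node hears is at least of the order of
`(c + 1) 2 ^ (i / 2) ≥ (c + 1) (ln n) ^ (3 / 2)`, which exceeds the threshold of its test. -/
lemma prob_nodeMisled_le (hn : 2 ≤ n) (hε0 : 0 < ε) (hε1 : ε ≤ 1) (hεn : 2 ≤ ε * n)
    (hε' : 0 < ε') (hc : 0 ≤ c) (hΛ : 1 ≤ Real.log n)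
    (hcΛ : (c + 1) / (1 - Real.exp (-64 * ε')) ≤ Real.log n ^ 3)
    (hεΛ : 160 / ε ≤ Real.sqrt (Real.log n))
    (hi : 3 * Real.logb 2 (Real.log n) ≤ i) (v : Fin n) :
    prob (run budget (protocol n ε' c) S t) (NodeMisled c ((1 - ε) * n) i v) ≤
      ENNReal.ofReal (Real.exp (-(c * Real.log n))) := by
  have hw : 0 < 1 - Real.exp (-64 * ε') := by
    have := one_sub_exp_neg_pos (x := 64 * ε') (by linarith)
    rwa [← neg_mul] at this
  have hΛ3 := log_pow_three_le (by linarith) hi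
  set Λ := Real.log n with hΛdef
  set w := 1 - Real.exp (-64 * ε') with hwdef
  have hw1 : w ≤ 1 := by
    have := Real.exp_pos (-64 * ε'); linarith
  have hL := le_phaseLen i
  have hs : Λ * Real.sqrt Λ ≤ Real.sqrt 2 ^ i := by
    rw [sqrt_two_pow]
    refine Real.le_sqrt_of_sq_le ?_
    rw [mul_pow, Real.sq_sqrt (by linarith)]
    calc Λ ^ 2 * Λ = Λ ^ 3 := by ring
      _ ≤ _ := hΛ3
  set q := (c + 1) / (w * 2 ^ i) with hq
  have hq0 : 0 ≤ q := by positivity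
  have hq1 : q ≤ 1 := by
    rw [hq, ← div_div, div_le_one (by positivity)]
    exact hcΛ.trans hΛ3
  refine le_trans (prob_few_hits_le budget (protocol n ε' c) S
    (fun _ h => Trial c ((1 - ε) * n) i .request h ∧ (know h).holds v.succ = false)
    (fun s h => isNoisy (heard (know h) s v.succ) = true) (by positivity : 0 ≤ q * (ε / 8))
    (fun h y hT => le_pr_node_noisy hn hε0.le hε1 hεn hT.1 hT.2 hq hq0 hq1 y) _ _ t) ?_
  refine ENNReal.ofReal_le_ofReal (Real.exp_le_exp.2 ?_)
  have h1 : (c + 1) * (Λ * (160 / ε)) ≤ q * phaseLen i := by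
    calc (c + 1) * (Λ * (160 / ε)) ≤ (c + 1) * Real.sqrt 2 ^ i := by
          refine mul_le_mul_of_nonneg_left (le_trans ?_ hs) (by linarith)
          exact mul_le_mul_of_nonneg_left hεΛ (by linarith)
      _ ≤ (c + 1) / w * Real.sqrt 2 ^ i := by
          refine mul_le_mul_of_nonneg_right ?_ (by positivity)
          rw [le_div_iff₀ hw]
          nlinarith
      _ = q * (2 ^ i * Real.sqrt 2 ^ i) := by rw [hq]; field_simp
      _ ≤ _ := by gcongr
  have h2 : 160 * ((c + 1) * Λ) ≤ q * phaseLen i * ε := by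
    calc 160 * ((c + 1) * Λ) = (c + 1) * (Λ * (160 / ε)) * ε := by field_simp
      _ ≤ _ := by gcongr
  nlinarith

variable {κ B : ℝ}

/-- In the round in which `2 ^ i` is about `κ n`, the number of relays after the inform phase is
at least of the order of `√n ln n`. -/
lemma prob_informFails_le (hε0 : 0 < ε) (hε' : 0 < ε') (hκ1 : 1 ≤ κ) (hκε : ε / ε' ≤ κ)
    (hi1 : κ * n ≤ 2 ^ i) (hi2 : (2 : ℝ) ^ i ≤ 2 * (κ * n)) (hΛn : 2 * Real.log n ≤ n)
    (hε'n : 2 / ε' ≤ n) (hn : 1 ≤ n) (hB : B ≤ phaseLen i / 2) {g : ℝ}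
    (hg : 8 * g / (ε / (ε' * κ)) ≤ Real.sqrt n) :
    prob (run budget (protocol n ε' c) S t) (InformFails c ((1 - ε) * n) i B
        (Real.log n * (ε / (ε' * κ)) * Real.sqrt 2 ^ i / 8)) ≤
      ENNReal.ofReal (Real.exp (-(g * Real.log n))) := by
  have hΛ : 0 ≤ Real.log n := Real.log_natCast_nonneg n
  have hn' : (1 : ℝ) ≤ n := by exact_mod_cast hn
  have hni : (n : ℝ) ≤ 2 ^ i := le_trans (by nlinarith) hi1
  set Λ := Real.log n with hΛdef
  set x := ε / (ε' * κ) with hx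
  have hx0 : 0 < x := by positivity
  have hx1 : x ≤ 1 := by
    rw [hx, ← div_div, div_le_one (by linarith)]; exact hκε
  set p := 2 * Λ / 2 ^ i with hp
  have hp0 : 0 ≤ p := by positivity
  have hp1 : p ≤ 1 := by rw [hp, div_le_one (by positivity)]; linarith
  set q := 2 / (ε' * 2 ^ i) with hq
  have hq0 : 0 ≤ q := by positivity
  have hq1 : q ≤ 1 := by
    rw [hq, ← div_div, div_le_one (by positivity)]; linarith
  have hxq : x ≤ q * (ε * n) := by
    calc x = 2 / (ε' * (2 * (κ * n))) * (ε * n) := by rw [hx]; field_simp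
      _ ≤ _ := by rw [hq]; gcongr
  refine le_trans (prob_few_hits_le budget (protocol n ε' c) S
    (fun y h => Trial c ((1 - ε) * n) i .inform h ∧ ¬ Attacked y)
    (fun s h => ∃ v : Fin n, (know h).holds v.succ = false ∧
        isMsg (heard (know h) s v.succ) = true) (by positivity : 0 ≤ p * (x / 2))
    (fun h y hT => le_pr_informed hx0.le hx1 hT.1 hp hp0 hp1 hq hq0 hq1 hxq hT.2) _ _ t) ?_
  refine ENNReal.ofReal_le_ofReal (Real.exp_le_exp.2 ?_)
  have hL := le_phaseLen i
  have h1 : Λ * x * Real.sqrt 2 ^ i / 2 ≤ p * (x / 2) * (phaseLen i - B) := by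
    calc Λ * x * Real.sqrt 2 ^ i / 2 = p * (x / 2) * ((2 ^ i * Real.sqrt 2 ^ i) / 2) := by
          rw [hp]; field_simp
      _ ≤ _ := by
          refine mul_le_mul_of_nonneg_left ?_ (by positivity)
          linarith
  have h2 : 8 * g ≤ x * Real.sqrt 2 ^ i := by
    rw [div_le_iff₀ hx0] at hg
    refine hg.trans ?_
    rw [mul_comm, sqrt_two_pow]
    gcongr
  nlinarith [mul_le_mul_of_nonneg_right h2 hΛ]

/-- In the same round, a given node hears the message at least of the order of `(c + 1) ln n` times
in expectation. -/
lemma prob_propagationFails_le (hε0 : 0 < ε) (hε' : 0 < ε') (hεε' : ε' ≤ ε / 160)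
    (hκ1 : 1 ≤ κ) (hi1 : κ * n ≤ 2 ^ i) (hc : 0 ≤ c)
    (hcn : 4 * Real.exp 1 * (c + 1) ≤ n) (hn : 2 ≤ n) (hB : B ≤ phaseLen i / 2) (v : Fin n) :
    prob (run budget (protocol n ε' c) S t) (PropagationFails c ((1 - ε) * n) i B
        (Real.log n * (ε / (ε' * κ)) * Real.sqrt 2 ^ i / 8) v) ≤
      ENNReal.ofReal (Real.exp (-(c * Real.log n))) := by
  have hΛ : 0 ≤ Real.log n := Real.log_natCast_nonneg n
  have hn' : (2 : ℝ) ≤ n := by exact_mod_cast hn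
  have hni : (n : ℝ) ≤ 2 ^ i := le_trans (by nlinarith) hi1
  set Λ := Real.log n with hΛdef
  set s₀ := Λ * (ε / (ε' * κ)) * Real.sqrt 2 ^ i / 8 with hs₀
  have hs0 : 0 ≤ s₀ := by positivity
  set q := 4 * Real.exp 1 * (c + 1) / 2 ^ i with hq
  have hq0 : 0 ≤ q := by positivity
  have hq1 : q ≤ 1 := by rw [hq, div_le_one (by positivity)]; linarith
  refine le_trans (prob_few_hits_le budget (protocol n ε' c) S
    (fun y h => (Trial c ((1 - ε) * n) i .propagation h ∧
      (know h).holds v.succ = false ∧ s₀ < (relays c h).card) ∧ ¬ Attacked y)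
    (fun s h => isMsg (heard (know h) s v.succ) = true)
    (by positivity : 0 ≤ q * (s₀ / n * Real.exp (-1)))
    (fun h y hT => le_pr_relayed hn hT.1.1 hT.1.2.1 hT.1.2.2 hq hq0 hq1 hT.2) _ _ t) ?_
  refine ENNReal.ofReal_le_ofReal (Real.exp_le_exp.2 ?_)
  have hL := le_phaseLen i
  have hr : Real.sqrt 2 ^ i * Real.sqrt 2 ^ i = 2 ^ i := by
    rw [← mul_pow, Real.mul_self_sqrt (by norm_num)]
  have he : Real.exp 1 * Real.exp (-1) = 1 := by rw [← Real.exp_add]; simp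
  have h1 : (c + 1) * Λ * (ε / ε') / 4 ≤ q * (s₀ / n * Real.exp (-1)) * (phaseLen i - B) := by
    calc (c + 1) * Λ * (ε / ε') / 4 = (c + 1) * Λ * (ε / (ε' * κ)) / (4 * n) * (κ * n) := by
          field_simp
      _ ≤ (c + 1) * Λ * (ε / (ε' * κ)) / (4 * n) * 2 ^ i := by gcongr
      _ = (Real.exp 1 * Real.exp (-1)) * (c + 1) * Λ * (ε / (ε' * κ)) / (4 * n) *
          (Real.sqrt 2 ^ i * Real.sqrt 2 ^ i) := by rw [he, hr, one_mul]
      _ = q * (s₀ / n * Real.exp (-1)) * ((2 ^ i * Real.sqrt 2 ^ i) / 2) := by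
          rw [hq, hs₀]; field_simp; ring
      _ ≤ _ := by
          refine mul_le_mul_of_nonneg_left ?_ (by positivity)
          linarith
  have h2 : 160 ≤ ε / ε' := by rw [le_div_iff₀ hε']; linarith
  have h3 : (c + 1) * Λ * 160 ≤ (c + 1) * Λ * (ε / ε') := by gcongr
  nlinarith [mul_nonneg hc hΛ]

end Failures

end Jam

namespace Jam

/-! ### The latency of the protocol -/

lemma exists_two_pow_near {x : ℝ} (hx : 1 ≤ x) : ∃ i : ℕ, 1 ≤ i ∧ x ≤ 2 ^ i ∧ 2 ^ i ≤ 2 * x := by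
  obtain ⟨m, h1, h2⟩ := exists_nat_pow_near hx (by norm_num : (1 : ℝ) < 2)
  exact ⟨m + 1, by omega, h2.le, by rw [pow_succ]; linarith⟩

section

variable {n b : ℕ} {ε' c : ℝ} (budget : Fin (b + 1) → ℝ) (S : Strategy n b Unit)

/-- The energy is spent at a rate that depends on the round only, so it is bounded in terms of the
number of slots, no matter when the devices terminate. -/
lemma prob_cost_le (hc : 0 ≤ c) (hε' : 0 < ε') {K : ℝ} (hK : 1 ≤ K) (hn : 1 ≤ n) {T : ℕ}
    (hT : (T : ℝ) ≤ K * (n * Real.sqrt n)) {C' : ℝ}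
    (hCA : 48 * (2 + c / (1 - Real.exp (-4 * ε'))) * Real.sqrt (2 * K) + 1 ≤ C')
    (hCV : 48 * (2 / ε' + 4 * Real.exp 1 * (c + 1) + (c + 1) / (1 - Real.exp (-64 * ε'))) *
      Real.sqrt (2 * K) + 2 * K + 1 ≤ C') :
    prob (run budget (protocol n ε' c) S T)
        (fun h => C' * Real.sqrt n * Real.log n ≤ cost h 0) ≤
      ENNReal.ofReal (Real.exp (-(Real.sqrt n * Real.log n))) ∧
    ∀ v : Fin n, prob (run budget (protocol n ε' c) S T)
        (fun h => C' * Real.sqrt n ≤ cost h v.succ) ≤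
      ENNReal.ofReal (Real.exp (-(Real.sqrt n))) := by
  have hw4 : 0 < 1 - Real.exp (-4 * ε') := by
    have := one_sub_exp_neg_pos (x := 4 * ε') (by linarith)
    rwa [← neg_mul] at this
  have hw64 : 0 < 1 - Real.exp (-64 * ε') := by
    have := one_sub_exp_neg_pos (x := 64 * ε') (by linarith)
    rwa [← neg_mul] at this
  have hn' : (1 : ℝ) ≤ n := by exact_mod_cast hn
  have hΛ : 0 ≤ Real.log n := Real.log_natCast_nonneg n
  set DA := 2 + c / (1 - Real.exp (-4 * ε')) with hDA
  set DV := 2 / ε' + 4 * Real.exp 1 * (c + 1) + (c + 1) / (1 - Real.exp (-64 * ε')) with hDV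
  have hDA0 : 0 ≤ DA := by positivity
  have hDV0 : 0 ≤ DV := by positivity
  obtain ⟨M, hM, hM1, hM2⟩ := exists_two_pow_near (x := K * n) (by nlinarith)
  have hTM : T ≤ roundStart (M + 1) := by
    rw [roundStart_succ hM]
    have h1 : (T : ℝ) ≤ phaseLen M := by
      refine hT.trans (le_trans ?_ (le_phaseLen M))
      rw [sqrt_two_pow, ← mul_assoc]
      exact mul_le_mul hM1 (Real.sqrt_le_sqrt (le_trans (by nlinarith) hM1)) (Real.sqrt_nonneg _)
        (by positivity)
    have h2 : T ≤ phaseLen M := by exact_mod_cast h1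
    omega
  have hsM : Real.sqrt 2 ^ M ≤ Real.sqrt (2 * K) * Real.sqrt n := by
    rw [sqrt_two_pow, ← Real.sqrt_mul (by linarith)]
    exact Real.sqrt_le_sqrt (by linarith)
  have hsn : 0 ≤ Real.sqrt n := Real.sqrt_nonneg _
  refine ⟨?_, fun v => ?_⟩
  · refine (prob_cost_ge_le budget (protocol n ε' c) S 0
      (fun t => DA * Real.log n * (1 / 2 ^ roundOf t))
      (fun h => pr_alice_active_le hc hε' h) _ T).trans
      (ENNReal.ofReal_le_ofReal (Real.exp_le_exp.2 ?_))
    have h1 := sum_cost_rate_le hTM (mul_nonneg hDA0 hΛ)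
    have h2 : DA * Real.log n * (24 * Real.sqrt 2 ^ M) ≤
        DA * Real.log n * (24 * (Real.sqrt (2 * K) * Real.sqrt n)) := by gcongr
    have h3 := mul_le_mul_of_nonneg_right hCA (mul_nonneg hsn hΛ)
    nlinarith
  · refine (prob_cost_ge_le budget (protocol n ε' c) S v.succ
      (fun t => DV * (1 / 2 ^ roundOf t) + 1 / n)
      (fun h => pr_node_active_le hc hε' h v) _ T).trans
      (ENNReal.ofReal_le_ofReal (Real.exp_le_exp.2 ?_))
    have h1 := sum_cost_rate_le hTM hDV0
    have h2 : DV * (24 * Real.sqrt 2 ^ M) ≤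
        DV * (24 * (Real.sqrt (2 * K) * Real.sqrt n)) := by gcongr
    have h3 := mul_le_mul_of_nonneg_right hCV hsn
    rw [Finset.sum_add_distrib, Finset.sum_const, Finset.card_range, nsmul_eq_mul]
    have h4 : (T : ℝ) * (1 / n) ≤ K * Real.sqrt n := by
      rw [mul_one_div, div_le_iff₀ (by linarith)]
      linarith
    nlinarith

/-- The union bound over everything that can go wrong. -/
lemma prob_failure_le {θ B s₀ δ x y : ℝ} {I T : ℕ} (hI : 1 ≤ I) (hθn : θ ≤ n)
    (hIT : roundStart (I + 1) ≤ T)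
    (hB : ∀ h ∈ (run budget (protocol n ε' c) S T).support, (attackedSlots h : ℝ) ≤ B)
    (h0 : prob (run budget (protocol n ε' c) S T) (fun h => x ≤ cost h 0) ≤ ENNReal.ofReal δ)
    (h1 : ∀ v : Fin n, prob (run budget (protocol n ε' c) S T) (fun h => y ≤ cost h v.succ) ≤
      ENNReal.ofReal δ)
    (hA : ∀ i : ℕ, 3 * Real.logb 2 (Real.log n) ≤ i →
      prob (run budget (protocol n ε' c) S T) (AliceMisled c θ i) ≤ ENNReal.ofReal δ)
    (hV : ∀ i : ℕ, 3 * Real.logb 2 (Real.log n) ≤ i → ∀ v,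
      prob (run budget (protocol n ε' c) S T) (NodeMisled c θ i v) ≤ ENNReal.ofReal δ)
    (hInf : prob (run budget (protocol n ε' c) S T) (InformFails c θ I B s₀) ≤ ENNReal.ofReal δ)
    (hProp : ∀ v, prob (run budget (protocol n ε' c) S T) (PropagationFails c θ I B s₀ v) ≤
      ENNReal.ofReal δ) :
    prob (run budget (protocol n ε' c) S T) (fun h => ¬ (θ ≤ informedCount h ∧
      (cost h 0 : ℝ) ≤ x ∧ ∀ v : Fin n, (cost h v.succ : ℝ) ≤ y)) ≤
      ((2 + 2 * n + I + I * n : ℕ) : ENNReal) * ENNReal.ofReal δ := by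
  let E : Unit ⊕ Fin n ⊕ Fin I ⊕ (Fin I × Fin n) ⊕ Unit ⊕ Fin n → List (Slot n b Unit) → Prop :=
    Sum.elim (fun _ h => x ≤ cost h 0)
    (Sum.elim (fun v h => y ≤ cost h v.succ)
    (Sum.elim (fun j h => 3 * Real.logb 2 (Real.log n) ≤ ((j + 1 : ℕ) : ℝ) ∧
      AliceMisled c θ (j + 1) h)
    (Sum.elim (fun j h => 3 * Real.logb 2 (Real.log n) ≤ ((j.1 + 1 : ℕ) : ℝ) ∧
      NodeMisled c θ (j.1 + 1) j.2 h)
    (Sum.elim (fun _ h => InformFails c θ I B s₀ h)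
    (fun v h => PropagationFails c θ I B s₀ v h)))))
  have hfalse : prob (run budget (protocol n ε' c) S T) (fun _ => False) = 0 := by simp [prob]
  have hE : ∀ j, prob (run budget (protocol n ε' c) S T) (E j) ≤ ENNReal.ofReal δ := by
    rintro (_ | v | j | ⟨j, v⟩ | _ | v)
    · exact h0
    · exact h1 v
    · by_cases hj : 3 * Real.logb 2 (Real.log n) ≤ ((j + 1 : ℕ) : ℝ)
      · exact (prob_mono _ fun h _ hh => hh.2).trans (hA _ hj)
      · exact (prob_mono _ fun h _ hh => hj hh.1).trans (hfalse.le.trans zero_le)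
    · by_cases hj : 3 * Real.logb 2 (Real.log n) ≤ ((j + 1 : ℕ) : ℝ)
      · exact (prob_mono _ fun h _ hh => hh.2).trans (hV _ hj v)
      · exact (prob_mono _ fun h _ hh => hj hh.1).trans (hfalse.le.trans zero_le)
    · exact hInf
    · exact hProp v
  refine le_trans (prob_mono _ (F := fun h => ∃ j, E j h) fun h hh => ?_)
    ((prob_exists_le _ E _ hE).trans ?_)
  · contrapose!
    intro hno
    refine ⟨le_informedCount_of_not_fails c (B := B) (s₀ := s₀) hI hθn
      (hIT.trans_eq (length_of_mem_support hh).symm) (hB h hh)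
      ?_ ?_ (hno (.inr (.inr (.inr (.inr (.inl ()))))))
      fun v => hno (.inr (.inr (.inr (.inr (.inr v))))), ?_, fun v => ?_⟩
    · intro i h1 h2 h3 hA
      obtain ⟨j, rfl⟩ := Nat.exists_eq_add_of_le' h1
      exact hno (.inr (.inr (.inl ⟨j, by omega⟩))) ⟨h3, hA⟩
    · intro i h1 h2 h3 v hV
      obtain ⟨j, rfl⟩ := Nat.exists_eq_add_of_le' h1
      exact hno (.inr (.inr (.inr (.inl (⟨j, by omega⟩, v))))) ⟨h3, hV⟩
    · exact (not_le.1 (hno (.inl ()))).le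
    · exact (not_le.1 (hno (.inr (.inl v)))).le
  · refine mul_le_mul_left (Nat.cast_le.2 (le_of_eq ?_)) _
    simp only [Fintype.card_sum, Fintype.card_unit, Fintype.card_fin, Fintype.card_prod]
    ring

end

/-- The protocol informs all but `ε n` nodes within `O(n^{3/2})` slots. -/
theorem eventually_latency {f C : ℝ} (hf : 0 < f) (hC : 0 < C) {ε γ ε' c : ℝ} (hε0 : 0 < ε)
    (hε1 : ε ≤ 1) (hγ : 0 < γ) (hε' : 0 < ε') (hεε' : ε' ≤ ε / 160) (hc : γ + 4 ≤ c) :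
    ∃ K C' : ℝ, 0 < K ∧ 0 < C' ∧ ∀ᶠ n : ℕ in atTop, ∀ S : Strategy n (byz f n) Unit,
      ENNReal.ofReal (1 - (n : ℝ) ^ (-γ)) ≤
        prob (run (advBudget C n (byz f n)) (protocol n ε' c) S ⌊K * (n : ℝ) ^ (3 / 2 : ℝ)⌋₊)
          (fun h => (1 - ε) * n ≤ informedCount h ∧
            (cost h 0 : ℝ) ≤ C' * Real.sqrt n * Real.log n ∧
            ∀ v : Fin n, (cost h v.succ : ℝ) ≤ C' * Real.sqrt n) := by
  have hw4 : 0 < 1 - Real.exp (-4 * ε') := by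
    have := one_sub_exp_neg_pos (x := 4 * ε') (by linarith)
    rwa [← neg_mul] at this
  have hw64 : 0 < 1 - Real.exp (-64 * ε') := by
    have := one_sub_exp_neg_pos (x := 64 * ε') (by linarith)
    rwa [← neg_mul] at this
  have hc0 : 0 ≤ c := by linarith
  set c₂ := C * (1 + f) with hc₂
  have hc₂0 : 0 < c₂ := by positivity
  -- in the last round that matters, `2 ^ I` is about `κ n`, and the adversary can attack at most
  -- half of a phase
  set κ := 1 + 2 * c₂ + ε / ε' with hκ
  have hr0 : 0 < ε / ε' := by positivity
  have hκ1 : 1 ≤ κ := by linarith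
  set K := 12 * (2 * κ * Real.sqrt (2 * κ)) + 1 with hK
  have hK1 : 1 ≤ K := by
    have : 0 ≤ 12 * (2 * κ * Real.sqrt (2 * κ)) := by positivity
    linarith
  set CA := 48 * (2 + c / (1 - Real.exp (-4 * ε'))) * Real.sqrt (2 * K) + 1 with hCA
  set CV := 48 * (2 / ε' + 4 * Real.exp 1 * (c + 1) + (c + 1) / (1 - Real.exp (-64 * ε'))) *
      Real.sqrt (2 * K) + 2 * K + 1 with hCV
  have hCA0 : 0 < CA := by positivity
  refine ⟨K, max CA CV, by linarith, lt_max_of_lt_left hCA0, ?_⟩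
  have hcast : Tendsto (fun n : ℕ => (n : ℝ)) atTop atTop := tendsto_natCast_atTop_atTop
  have hlog : Tendsto (fun n : ℕ => Real.log n) atTop atTop := Real.tendsto_log_atTop.comp hcast
  have hsqrt : Tendsto (fun n : ℕ => Real.sqrt n) atTop atTop :=
    Real.tendsto_sqrt_atTop.comp hcast
  have hloglt : ∀ᶠ n : ℕ in atTop, (γ + 4) * Real.log n ≤ Real.sqrt n := by
    have h1 := (isLittleO_log_rpow_atTop (r := 1 / 2) (by norm_num)).comp_tendsto hcast
    have h2 := h1.bound (show 0 < 1 / (γ + 4) by positivity)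
    filter_upwards [h2] with n hn
    simp only [Function.comp, Real.norm_eq_abs] at hn
    rw [abs_of_nonneg (Real.log_natCast_nonneg n), abs_of_nonneg (by positivity),
      ← Real.sqrt_eq_rpow, one_div, ← div_eq_inv_mul, le_div_iff₀ (by linarith)] at hn
    linarith
  have hlog2 : Tendsto (fun n : ℕ => Real.log n ^ 2) atTop atTop :=
    (tendsto_pow_atTop two_ne_zero).comp hlog
  have hlog3 : Tendsto (fun n : ℕ => Real.log n ^ 3) atTop atTop :=
    (tendsto_pow_atTop three_ne_zero).comp hlog
  have hsqrtlog : Tendsto (fun n : ℕ => Real.sqrt (Real.log n)) atTop atTop :=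
    Real.tendsto_sqrt_atTop.comp hlog
  filter_upwards [hcast.eventually_ge_atTop 3, hcast.eventually_ge_atTop (2 / ε),
    hcast.eventually_ge_atTop (2 / ε'), hcast.eventually_ge_atTop (4 * Real.exp 1 * (c + 1)),
    hcast.eventually_ge_atTop (2 * κ), hlog.eventually_ge_atTop 1,
    hlog2.eventually_ge_atTop (c / (1 - Real.exp (-4 * ε'))),
    hlog3.eventually_ge_atTop ((c + 1) / (1 - Real.exp (-64 * ε'))),
    hsqrtlog.eventually_ge_atTop (160 / ε),
    hsqrt.eventually_ge_atTop (8 * (γ + 4) / (ε / (ε' * κ))),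
    hsqrt.eventually_ge_atTop (γ + 4), hloglt]
    with n hn3 hnε hnε' hnc hnκ hΛ1 hΛ2 hΛ3 hsΛ hns hns2 hlogn S
  have hn3' : 3 ≤ n := by exact_mod_cast hn3
  rw [div_le_iff₀ hε0] at hnε
  have hsn1 : Real.sqrt n ≤ n := Real.sqrt_le_self_iff.2 (Or.inr (by linarith))
  obtain ⟨I, hI, hI1, hI2⟩ := exists_two_pow_near (x := κ * n) (by nlinarith)
  rw [rpow_three_halves _ (Nat.cast_nonneg n)]
  have hnn0 : (0 : ℝ) ≤ n * Real.sqrt n := by positivity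
  set T := ⌊K * (n * Real.sqrt n)⌋₊ with hT
  have hTle : (T : ℝ) ≤ K * (n * Real.sqrt n) := Nat.floor_le (by positivity)
  have hIT : roundStart (I + 1) ≤ T := by
    refine Nat.le_floor ((roundStart_succ_le I).trans ?_)
    calc 12 * ((2 : ℝ) ^ I * Real.sqrt 2 ^ I)
        ≤ 12 * ((2 * κ * n) * (Real.sqrt (2 * κ) * Real.sqrt n)) := by
          rw [sqrt_two_pow, ← Real.sqrt_mul (by linarith)]
          gcongr <;> linarith
      _ = 12 * (2 * κ * Real.sqrt (2 * κ)) * (n * Real.sqrt n) := by ring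
      _ ≤ K * (n * Real.sqrt n) := by
          refine mul_le_mul_of_nonneg_right ?_ hnn0
          linarith
  set B := c₂ * (n * Real.sqrt n) with hB
  have hBL : B ≤ phaseLen I / 2 := by
    have h1 : κ * n * Real.sqrt n ≤ phaseLen I := by
      refine le_trans ?_ (le_phaseLen I)
      rw [sqrt_two_pow]
      refine mul_le_mul hI1 (Real.sqrt_le_sqrt (le_trans ?_ hI1)) (Real.sqrt_nonneg _)
        (by positivity)
      nlinarith
    have h2 : 2 * c₂ * (n * Real.sqrt n) ≤ κ * (n * Real.sqrt n) :=
      mul_le_mul_of_nonneg_right (by linarith) hnn0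
    rw [hB]
    linarith
  set δ := Real.exp (-((γ + 4) * Real.log n)) with hδ
  have hcδ : ENNReal.ofReal (Real.exp (-(c * Real.log n))) ≤ ENNReal.ofReal δ := by
    refine ENNReal.ofReal_le_ofReal (Real.exp_le_exp.2 (neg_le_neg ?_))
    gcongr
  set P := run (advBudget C n (byz f n)) (protocol n ε' c) S T with hP
  set s₀ := Real.log n * (ε / (ε' * κ)) * Real.sqrt 2 ^ I / 8 with hs₀
  have hcost := prob_cost_le (advBudget C n (byz f n)) S hc0 hε' hK1 (by omega) hTle
    (le_max_left CA CV) (le_max_right CA CV)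
  have h2Λ : 2 * Real.log n ≤ n := by
    have := mul_le_mul_of_nonneg_right (show 2 ≤ γ + 4 by linarith)
      (show 0 ≤ Real.log n by linarith)
    linarith
  have hθn : (1 - ε) * n ≤ n := by
    have : 0 ≤ ε * n := by positivity
    linarith
  have hsΛn : (γ + 4) * Real.log n ≤ Real.sqrt n * Real.log n := by gcongr
  have hbad := prob_failure_le (c := c) (δ := δ) (s₀ := s₀) _ S hI hθn hIT
    (fun h hh => attackedSlots_le hf hC n S _ T hh)
    (hcost.1.trans (ENNReal.ofReal_le_ofReal (Real.exp_le_exp.2 (neg_le_neg hsΛn))))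
    (fun v => (hcost.2 v).trans
      (ENNReal.ofReal_le_ofReal (Real.exp_le_exp.2 (neg_le_neg hlogn))))
    (fun i hi => (prob_aliceMisled_le _ S T (by omega) hε0.le hε1 hε' hεε' hc0 hΛ1 hΛ2 hi).trans
      hcδ)
    (fun i hi v => (prob_nodeMisled_le _ S T (by omega) hε0 hε1 (by linarith) hε' hc0 hΛ1 hΛ3
      hsΛ hi v).trans hcδ)
    (prob_informFails_le _ S T hε0 hε' hκ1 (by linarith) hI1 hI2 h2Λ hnε' (by omega) hBL hns)
    (fun v => (prob_propagationFails_le _ S T hε0 hε' hεε' hκ1 hI1 hc0 hnc (by omega) hBL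
      v).trans hcδ)
  have hIn : I ≤ n ^ 2 := by
    have h1 : ((2 ^ I : ℕ) : ℝ) ≤ ((n ^ 2 : ℕ) : ℝ) := by
      push_cast
      calc (2 : ℝ) ^ I ≤ 2 * κ * n := by linarith
        _ ≤ n * n := by gcongr
        _ = _ := (sq _).symm
    exact (Nat.lt_two_pow_self (n := I)).le.trans (by exact_mod_cast h1)
  have hcard : 2 + 2 * n + I + I * n ≤ n ^ 4 := by
    have h1 : I * n ≤ n ^ 2 * n := Nat.mul_le_mul_right _ hIn
    have h2 := Nat.mul_le_mul_right (n ^ 3) hn3'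
    have h3 := Nat.mul_le_mul_right (n ^ 2) hn3'
    have h4 := Nat.mul_le_mul_right n hn3'
    rw [show n ^ 4 = n * n ^ 3 by ring]
    rw [show n * n ^ 2 = n ^ 3 by ring] at h3
    rw [show n * n = n ^ 2 by ring] at h4
    rw [show n ^ 2 * n = n ^ 3 by ring] at h1
    omega
  have hn0 : (0 : ℝ) < n := by linarith
  have hδn : ((2 + 2 * n + I + I * n : ℕ) : ENNReal) * ENNReal.ofReal δ ≤
      ENNReal.ofReal ((n : ℝ) ^ (-γ)) := by
    calc _ ≤ ((n ^ 4 : ℕ) : ENNReal) * ENNReal.ofReal δ := by gcongr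
      _ = ENNReal.ofReal ((n : ℝ) ^ 4 * δ) := by
          rw [ENNReal.ofReal_mul (by positivity), ← Nat.cast_pow, ENNReal.ofReal_natCast]
      _ = ENNReal.ofReal ((n : ℝ) ^ (-γ)) := by
          congr 1
          rw [Real.rpow_def_of_pos hn0, hδ]
          nth_rw 1 [← Real.exp_log hn0]
          rw [← Real.exp_nat_mul, ← Real.exp_add]
          congr 1; push_cast; ring
  rw [ENNReal.ofReal_sub _ (by positivity), ENNReal.ofReal_one, tsub_le_iff_right]
  rw [← prob_add_prob_not P]
  exact add_le_add_right (hbad.trans hδn) _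

end Jam

end

theorem mainTheorem4 (f C : ℝ) (hf : 0 < f) (hC : 0 < C) :
    -- Carol and her Byzantine nodes can jam continuously for `Θ(n^{3/2})` slots
    (∃ c₁ c₂ : ℝ, 0 < c₁ ∧ 0 < c₂ ∧ ∀ᶠ n : ℕ in atTop, ∀ Φ : Type,
      (∃ S : Jam.Strategy n (Jam.byz f n) Φ, ∀ A : Jam.Algorithm n Φ, ∀ t : ℕ,
        (t : ℝ) ≤ c₁ * (n : ℝ) ^ (3 / 2 : ℝ) →
        ∀ h ∈ (Jam.run (Jam.advBudget C n (Jam.byz f n)) A S t).support,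
          Jam.ContinuouslyJammed h ∧ Jam.informedCount h = 0) ∧
      (∀ (S : Jam.Strategy n (Jam.byz f n) Φ) (A : Jam.Algorithm n Φ) (t : ℕ),
        ∀ h ∈ (Jam.run (Jam.advBudget C n (Jam.byz f n)) A S t).support,
          (Jam.attackedSlots h : ℝ) ≤ c₂ * (n : ℝ) ^ (3 / 2 : ℝ))) ∧
    -- no algorithm delivers the message to any correct node in `o(n^{3/2})` slots
    (∀ T : ℕ → ℕ, (fun n => (T n : ℝ)) =o[atTop] (fun n : ℕ => (n : ℝ) ^ (3 / 2 : ℝ)) →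
      ∀ᶠ n : ℕ in atTop, ∀ (Φ : Type) (A : Jam.Algorithm n Φ),
        ∃ S : Jam.Strategy n (Jam.byz f n) Φ,
          Jam.prob (Jam.run (Jam.advBudget C n (Jam.byz f n)) A S (T n))
            (fun h => 1 ≤ Jam.informedCount h) = 0) ∧
    -- the latency of the protocol is `O(n^{3/2})`, with high probability
    (∀ ε γ : ℝ, 0 < ε → 0 < γ →
      ∃ ε₀ : ℝ, 0 < ε₀ ∧ ∀ ε' : ℝ, 0 < ε' → ε' ≤ ε₀ →
      ∃ c₀ : ℝ, 0 < c₀ ∧ ∀ c : ℝ, c₀ ≤ c →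
      ∃ K C' : ℝ, 0 < K ∧ 0 < C' ∧ ∀ᶠ n : ℕ in atTop,
        ∀ S : Jam.Strategy n (Jam.byz f n) Unit,
          ENNReal.ofReal (1 - (n : ℝ) ^ (-γ)) ≤
            Jam.prob (Jam.run (Jam.advBudget C n (Jam.byz f n)) (Jam.protocol n ε' c) S
                ⌊K * (n : ℝ) ^ (3 / 2 : ℝ)⌋₊)
              (fun h => (1 - ε) * n ≤ Jam.informedCount h ∧
                (Jam.cost h 0 : ℝ) ≤ C' * Real.sqrt n * Real.log n ∧
                ∀ v : Fin n, (Jam.cost h v.succ : ℝ) ≤ C' * Real.sqrt n)) := by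
  refine ⟨⟨f * C / 4, C * (1 + f), by positivity, by positivity, ?_⟩, fun T hT => ?_,
    fun ε γ hε hγ => ?_⟩
  · filter_upwards [Jam.eventually_jamming hf hC] with n hn Φ
    refine ⟨hn Φ, fun S A t h hh => ?_⟩
    rw [Jam.rpow_three_halves _ (Nat.cast_nonneg n)]
    exact Jam.attackedSlots_le hf hC n S A t hh
  · filter_upwards [Jam.eventually_jamming hf hC,
      hT.bound (show 0 < f * C / 4 by positivity)] with n hn hTn Φ A
    obtain ⟨S, hS⟩ := hn Φ
    refine ⟨S, ?_⟩
    rw [Real.norm_of_nonneg (Nat.cast_nonneg _), Real.norm_of_nonneg (by positivity)] at hTn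
    rw [Jam.prob, PMF.toOuterMeasure_apply_eq_zero_iff, Set.disjoint_left]
    intro h hh h1
    have := (hS A (T n) hTn h hh).2
    simp only [Set.mem_ofPred_eq] at h1
    omega
  · refine ⟨min ε 1 / 160, by positivity, fun ε' hε' hεε' => ⟨γ + 4, by linarith,
      fun c hc => ?_⟩⟩
    obtain ⟨K, C', hK, hC', hev⟩ := Jam.eventually_latency hf hC (lt_min hε one_pos)
      (min_le_right ε 1) hγ hε' hεε' hc
    refine ⟨K, C', hK, hC', ?_⟩
    filter_upwards [hev] with n hn S
    refine (hn S).trans (Jam.prob_mono _ fun h _ hh => ⟨le_trans ?_ hh.1, hh.2⟩)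
    have : min ε 1 ≤ ε := min_le_left ε 1
    gcongr
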